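/- Let $\Theta=(\theta_m)_{m\ge 1}$ be a sequence of non-negative real numbers. For a permutation $\sigma\in S_n$ with cycle lengths $\lambda_1,\dots,\lambda_\ell$ (fixed points counted as cycles of length $1$) let $C_m(\sigma)$ be the number of cycles of length $m$, put $h_n:=\frac1{n!}\sum_{\sigma\in S_n}\prod_{i=1}^{\ell}\theta_{\lambda_i}$ and, whenever $h_n>0$, let $\mathbb P_\Theta$ be the probability measure on $S_n$ with $\mathbb P_\Theta[\sigma]=\frac1{h_n\,n!}\prod_{i=1}^{\ell}\theta_{\lambda_i}$, with expectation $\mathbb E_\Theta$ (no restriction on the cycle lengths, i.e. $A_n=\{1,\dots,n\}$). For $0<r<R$ and $0<\phi<\pi/2$ let $\Delta_0(r,R,\phi)=\{z\in\mathbb C: |z|<R,\ z\ne r,\ |\arg(z-r)|>\phi\}$. For $r,\vartheta>0$ and $K\in\mathbb R$ let $\mathcal F(r,\vartheta,K)$ be the set of functions $g$ that, for some $R>r$ and $0<\phi<\pi/2$, are holomorphic in $\Delta_0(r,R,\phi)$ and satisfy $g(t)=\vartheta\log\frac{1}{1-t/r}+K+O(t-r)$ as $t\to r$ in $\Delta_0(r,R,\phi)$.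 Suppose that $g_\Theta(t)=\sum_{m\ge1}\frac{\theta_m}{m}t^m$ converges near $0$ and (its analytic continuation) belongs to $\mathcal F(r,\vartheta,K)$. Fix $x\in[0,1)$ and put $D_x=D_x(n)=\{1,\dots,\lfloor n^x\rfloor\}$, $B_n(x)=\sum_{m\in D_x}C_m$ and $L_{D_x}(r)=\sum_{m\in D_x}\frac{\theta_m}{m}r^m$. Then $h_n>0$ for all sufficiently large $n$, and, as $n\to\infty$, $$\mathbb E_\Theta\bigl[e^{isB_n(x)}\bigr]=\exp\bigl((e^{is}-1)L_{D_x}(r)\bigr)\bigl(1+O(n^{x-1})\bigr)$$ uniformly in $s\in\mathbb R$. In particular the sequence $(B_n(x))_n$ is strongly mod-Poisson convergent with parameters $L_{D_x}(r)$ and limiting function $1$; that is, $$\exp\bigl(L_{D_x}(r)(1-e^{is})\bigr)\,\mathbb E_\Theta\bigl[e^{isB_n(x)}\bigr]\longrightarrow 1\qquad(n\to\infty)$$ locally uniformly in $s\in\mathbb R$. -/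

import Mathlib

open Filter Topology MeasureTheory

noncomputable section

namespace WeightedPerm

/-- The number `C_m` of cycles of length `m` of a permutation `σ` of `n` letters
(fixed points are cycles of length `1`; `σ.partition` is the full cycle type of `σ`). -/
def cycleCount {n : ℕ} (σ : Equiv.Perm (Fin n)) (m : ℕ) : ℕ :=
  σ.partition.parts.count m

/-- The weight `∏ θ_{λ_i} 1_{λ_i ∈ A}`, the product running over all cycle lengths `λ_i` of `σ`. -/
def weight (θ : ℕ → ℝ) (A : Finset ℕ) {n : ℕ} (σ : Equiv.Perm (Fin n)) : ℝ :=
  (σ.partition.parts.map fun m => if m ∈ A then θ m else 0).prod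

/-- The normalization constant `h_n(A)`. -/
def normConst (θ : ℕ → ℝ) (A : Finset ℕ) (n : ℕ) : ℝ :=
  (1 / (n.factorial : ℝ)) * ∑ σ : Equiv.Perm (Fin n), weight θ A σ

/-- All subsets of the finite symmetric group are measurable. -/
instance instMeasurableSpacePermFin (n : ℕ) : MeasurableSpace (Equiv.Perm (Fin n)) := ⊤

/-- The `A`-weighted measure on the symmetric group on `n` letters: the permutation `σ` has mass
`weight θ A σ / (h_n(A) n!)`. It is a probability measure whenever `θ ≥ 0` and `h_n(A) ≠ 0`. -/
def weightedMeasure (θ : ℕ → ℝ) (A : Finset ℕ) (n : ℕ) : Measure (Equiv.Perm (Fin n)) :=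
  ∑ σ : Equiv.Perm (Fin n),
    ENNReal.ofReal (1 / (normConst θ A n * (n.factorial : ℝ)) * weight θ A σ) • Measure.dirac σ

/-- The weighted measure without restriction on the cycle lengths, `A_n = {1, …, n}`. -/
def freeMeasure (θ : ℕ → ℝ) (n : ℕ) : Measure (Equiv.Perm (Fin n)) :=
  weightedMeasure θ (Finset.Icc 1 n) n

/-- The set `D_x = {1, …, ⌊n ^ x⌋}`. -/
def smallLengths (n : ℕ) (x : ℝ) : Finset ℕ :=
  Finset.Icc 1 ⌊(n : ℝ) ^ x⌋₊

/-- `B_n(x) = ∑_{m ≤ ⌊n ^ x⌋} C_m`, the number of cycles of length at most `n ^ x`. -/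
def smallCycles {n : ℕ} (x : ℝ) (σ : Equiv.Perm (Fin n)) : ℕ :=
  ∑ m ∈ smallLengths n x, cycleCount σ m

/-- `L_D(t) = ∑_{m ∈ D} (θ_m / m) t ^ m`, for a finite set `D` of positive integers. -/
def partialSeries (θ : ℕ → ℝ) (D : Finset ℕ) (t : ℝ) : ℝ :=
  ∑ m ∈ D, θ m / (m : ℝ) * t ^ m

/-- The domain `Δ_0(r, R, φ)`: the disc of radius `R` around `0`, slit along a closed cone
at `r` of half-angle `φ`. -/
def deltaDomain (r R φ : ℝ) : Set ℂ :=
  {z : ℂ | ‖z‖ < R ∧ z ≠ (r : ℂ) ∧ φ < |Complex.arg (z - (r : ℂ))|}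

/-- The function class `F(r, ϑ, K)`. -/
def functionClass (r ϑ K : ℝ) : Set (ℂ → ℂ) :=
  {g : ℂ → ℂ | ∃ R φ : ℝ, r < R ∧ 0 < φ ∧ φ < Real.pi / 2 ∧
    DifferentiableOn ℂ g (deltaDomain r R φ) ∧
    (fun t : ℂ => g t - ((ϑ : ℂ) * Complex.log (1 / (1 - t / (r : ℂ))) + (K : ℂ)))
      =O[𝓝[deltaDomain r R φ] (r : ℂ)] fun t : ℂ => t - (r : ℂ)}

/-- `g` is given near `0` by the convergent power series `g_Θ(t) = ∑_{m ≥ 1} (θ_m / m) t ^ m`. -/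
def IsGeneratingFunction (θ : ℕ → ℝ) (g : ℂ → ℂ) : Prop :=
  ∀ᶠ t in 𝓝 (0 : ℂ),
    HasSum (fun k : ℕ => (θ (k + 1) : ℂ) / ((k + 1 : ℕ) : ℂ) * t ^ (k + 1)) (g t)

/-- `g_Θ ∈ F(r, ϑ, K)`: the power series `g_Θ` converges near `0` and its sum extends analytically
to a function in `F(r, ϑ, K)`. -/
def SeriesMemClass (θ : ℕ → ℝ) (r ϑ K : ℝ) : Prop :=
  ∃ g ∈ functionClass r ϑ K, IsGeneratingFunction θ g

/-- Strong mod-Poisson convergence, with parameters `lam n` and limiting function `Φ`, of a sequence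
of real random variables with laws `μ n` (which have to be defined only for all large `n`):
the characteristic function of `μ n`, divided by the characteristic function
`exp (lam n (e ^ {is} - 1))` of the Poisson law, converges to `Φ` locally uniformly on `ℝ`. -/
structure StrongModPoisson (μ : ℕ → Measure ℝ) (lam : ℕ → ℝ) (Φ : ℝ → ℂ) : Prop where
  isProbability : ∀ᶠ n in atTop, IsProbabilityMeasure (μ n)
  tendsto : TendstoLocallyUniformly
    (fun (n : ℕ) (s : ℝ) =>
      Complex.exp ((lam n : ℂ) * (1 - Complex.exp (Complex.I * (s : ℂ)))) * charFun (μ n) s)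
    Φ atTop

end WeightedPerm

end

noncomputable section

namespace WeightedPerm

/-! By the exponential formula (`taylorCoeff_exp`), `h_n` is the `n`-th coefficient of `exp g`.
Multiplying `θ_m` by `w = e^{is}` for `m ∈ D` turns this function into `exp (g + (w - 1) L_D)`, and
the characteristic function is the ratio of the two `n`-th coefficients. Replacing `L_D` by its
value at the singularity produces exactly the Poisson factor. What is left to estimate is the `n`-th
coefficient of `exp g * (exp u - 1)`, where `u = (w - 1)(L_D - L_D(r))` vanishes at `r`.

Rescaling reduces to `r = 1`. Put `M = n^x`. Within `1/M` of the singularity, `u = O(M |1 - z|)`, so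
the error function is `O(M |1 - z|^{1 - ϑ})` and contributes `O(M n^{ϑ - 2})`, which is `n^{x - 1}`
times `n^{ϑ - 1}`. Further away, but for `|z| ≤ 1 + 1/M`, `u` is `O(1 + log M)`, so the error
function is bounded by a fixed power of `M`. The transfer estimate
`norm_taylorCoeff_le_of_indentedDisc` multiplies this bound by `(M/n)^k = n^{-k(1 - x)}` with `k`
arbitrary, which is negligible because `x < 1`.

These estimates are combined in `exists_norm_taylorCoeff_twist_le`. They need bounded weights
(`exists_weight_bound`) and the lower bound `h_n ≥ κ n^{ϑ - 1}` (`exists_le_norm_cycleSum`). Both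
come from the same transfer principle, the latter by comparison with `e^K (1 - z)^{-ϑ}`. Only `|w -
1| ≤ 2` is used, hence the uniformity in `s`. -/

/-! ### Cycle sums as sums over partitions, and their recurrence -/

/-- The cycle sum `(1 / n!) ∑_σ ∏ a_{λ_i}` for complex cycle weights `a`. -/
def cycleSum (a : ℕ → ℂ) (n : ℕ) : ℂ :=
  (1 / (n.factorial : ℂ)) * ∑ σ : Equiv.Perm (Fin n), (σ.partition.parts.map a).prod

/-- The contribution of a cycle type to `cycleSum`. -/
def typeWeight (a : ℕ → ℂ) (s : Multiset ℕ) : ℂ :=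
  ∏ m ∈ s.toFinset, (a m / m) ^ s.count m / ((s.count m).factorial : ℂ)

/-- `cycleType` omits fixed points, but nothing is lost: the remaining parts are ones, and the total
fixes their number. -/
theorem partition_eq_iff {n : ℕ} (σ : Equiv.Perm (Fin n))
    (p : (Fintype.card (Fin n)).Partition) :
    σ.partition = p ↔ σ.cycleType = p.parts.filter (2 ≤ ·) := by
  constructor
  · rintro rfl
    exact Equiv.Perm.filter_parts_partition_eq_cycleType.symm
  · intro h
    have hone : p.parts.filter (fun m => ¬ 2 ≤ m) =
        Multiset.replicate (p.parts.filter (fun m => ¬ 2 ≤ m)).card 1 := by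
      rw [Multiset.eq_replicate_card]
      intro b hb
      have h1 := Multiset.mem_filter.1 hb
      have h2 := p.parts_pos h1.1
      omega
    have hsum := p.parts_sum
    rw [← Multiset.filter_add_not (2 ≤ ·) p.parts, Multiset.sum_add, hone, ← h,
      Equiv.Perm.sum_cycleType, Multiset.sum_replicate] at hsum
    rw [Nat.Partition.ext_iff, Equiv.Perm.parts_partition,
      ← Multiset.filter_add_not (2 ≤ ·) p.parts, ← h, hone]
    congr 2
    simp only [smul_eq_mul, mul_one] at hsum
    omega

/-- Cauchy's formula for conjugacy class sizes. It follows from the count by `cycleType`, where the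
fixed points enter through the factorial of their number; as parts equal to one they do not change
the product of the parts. -/
theorem card_partition_mul {n : ℕ} (p : (Fintype.card (Fin n)).Partition) :
    (Finset.univ.filter fun σ : Equiv.Perm (Fin n) => σ.partition = p).card *
      (p.parts.prod * ∏ m ∈ p.parts.toFinset, (p.parts.count m).factorial) = n.factorial := by
  have hone : p.parts.filter (fun m => ¬ 2 ≤ m) =
      Multiset.replicate (p.parts.count 1) 1 := by
    rw [← Multiset.filter_eq']
    refine Multiset.filter_congr fun b hb => ?_
    have h2 := p.parts_pos hb
    omega
  have hsplit := Multiset.filter_add_not (2 ≤ ·) p.parts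
  have hsum := p.parts_sum
  rw [← hsplit, Multiset.sum_add, hone, Multiset.sum_replicate, smul_eq_mul, mul_one] at hsum
  have hprod : p.parts.prod = (p.parts.filter (2 ≤ ·)).prod := by
    conv_lhs => rw [← hsplit, Multiset.prod_add, hone]
    simp
  have hcount : ∏ m ∈ p.parts.toFinset, (p.parts.count m).factorial =
      (p.parts.count 1).factorial *
        ∏ m ∈ (p.parts.filter (2 ≤ ·)).toFinset,
          ((p.parts.filter (2 ≤ ·)).count m).factorial := by
    have h1 : ∏ m ∈ p.parts.toFinset, (p.parts.count m).factorial =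
        ∏ m ∈ insert 1 (p.parts.filter (2 ≤ ·)).toFinset, (p.parts.count m).factorial := by
      refine Finset.prod_subset ?_ ?_
      · intro m hm
        have hm' := Multiset.mem_toFinset.1 hm
        have h2 := p.parts_pos hm'
        simp only [Finset.mem_insert, Multiset.mem_toFinset, Multiset.mem_filter, hm', true_and]
        omega
      · intro m _ hm
        rw [Multiset.mem_toFinset] at hm
        rw [Multiset.count_eq_zero_of_notMem hm, Nat.factorial_zero]
    rw [h1, Finset.prod_insert (by simp)]
    congr 1
    refine Finset.prod_congr rfl fun m hm => ?_
    rw [Multiset.count_filter_of_pos]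
    exact (Multiset.mem_filter.1 (Multiset.mem_toFinset.1 hm)).2
  have key := Equiv.Perm.card_of_cycleType_mul_eq (Fin n) (p.parts.filter (2 ≤ ·))
  rw [if_pos ⟨by omega, fun a ha => (Multiset.mem_filter.1 ha).2⟩] at key
  simp only [partition_eq_iff]
  rw [hprod, hcount]
  have hk : Fintype.card (Fin n) - (p.parts.filter (2 ≤ ·)).sum = p.parts.count 1 := by omega
  rw [hk] at key
  have hn : (Fintype.card (Fin n)).factorial = n.factorial := by rw [Fintype.card_fin]
  rw [← hn, ← key]
  ring

theorem cycleSum_eq_sum_typeWeight (a : ℕ → ℂ) (n : ℕ) :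
    cycleSum a n = ∑ p : n.Partition, typeWeight a p.parts := by
  have hn : Fintype.card (Fin n) = n := Fintype.card_fin n
  have h0 : ∑ p : n.Partition, typeWeight a p.parts =
      ∑ p : (Fintype.card (Fin n)).Partition, typeWeight a p.parts := by rw [hn]
  rw [h0, cycleSum, ← Finset.sum_fiberwise Finset.univ (fun σ => σ.partition), Finset.mul_sum]
  refine Finset.sum_congr rfl fun p _ => ?_
  have h1 : ∑ σ : Equiv.Perm (Fin n) with σ.partition = p, (σ.partition.parts.map a).prod =
      ((Finset.univ.filter fun σ : Equiv.Perm (Fin n) => σ.partition = p).card : ℂ) *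
        (p.parts.map a).prod := by
    rw [← nsmul_eq_mul, ← Finset.sum_const]
    refine Finset.sum_congr rfl fun σ hσ => ?_
    rw [(Finset.mem_filter.1 hσ).2]
  have hcard := congrArg (Nat.cast : ℕ → ℂ) (card_partition_mul p)
  push_cast at hcard
  have hpp : (p.parts.map (Nat.cast : ℕ → ℂ)).prod =
      ∏ m ∈ p.parts.toFinset, (m : ℂ) ^ p.parts.count m := Finset.prod_multiset_map_count _ _
  have hparts : (p.parts.map (Nat.cast : ℕ → ℂ)).prod ≠ 0 := by
    rw [hpp]
    refine Finset.prod_ne_zero_iff.2 fun m hm => pow_ne_zero _ (Nat.cast_ne_zero.2 ?_)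
    exact (p.parts_pos (Multiset.mem_toFinset.1 hm)).ne'
  have hfac : ∏ m ∈ p.parts.toFinset, ((p.parts.count m).factorial : ℂ) ≠ 0 :=
    Finset.prod_ne_zero_iff.2 fun m _ => Nat.cast_ne_zero.2 (Nat.factorial_ne_zero _)
  have hf : (n.factorial : ℂ) ≠ 0 := Nat.cast_ne_zero.2 (Nat.factorial_ne_zero _)
  rw [h1, typeWeight, Finset.prod_div_distrib]
  simp only [div_pow]
  rw [Finset.prod_div_distrib, ← hpp, Finset.prod_multiset_map_count p.parts a]
  field_simp
  rw [← hcard]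
  ring

/-- Only the factor at `i` changes: it gains `a i / i` and its factorial gains the new multiplicity.
-/
theorem typeWeight_cons (a : ℕ → ℂ) {i : ℕ} (hi : i ≠ 0) (s : Multiset ℕ) :
    (i : ℂ) * ((i ::ₘ s).count i : ℂ) * typeWeight a (i ::ₘ s) = a i * typeWeight a s := by
  have h1 : ∀ t : Multiset ℕ, t.toFinset ⊆ insert i s.toFinset → typeWeight a t =
      ∏ m ∈ insert i s.toFinset, (a m / m) ^ t.count m / ((t.count m).factorial : ℂ) := by
    intro t ht
    refine Finset.prod_subset ht fun m _ hm => ?_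
    rw [Multiset.mem_toFinset] at hm
    simp [Multiset.count_eq_zero_of_notMem hm]
  rw [h1 _ (by simp), h1 s (Finset.subset_insert _ _),
    ← Finset.mul_prod_erase _ _ (Finset.mem_insert_self i s.toFinset),
    ← Finset.mul_prod_erase _ _ (Finset.mem_insert_self i s.toFinset)]
  have h2 : ∏ m ∈ (insert i s.toFinset).erase i,
      (a m / m) ^ (i ::ₘ s).count m / (((i ::ₘ s).count m).factorial : ℂ) =
      ∏ m ∈ (insert i s.toFinset).erase i, (a m / m) ^ s.count m / ((s.count m).factorial : ℂ) := by
    refine Finset.prod_congr rfl fun m hm => ?_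
    rw [Multiset.count_cons_of_ne (Finset.ne_of_mem_erase hm)]
  rw [h2, Multiset.count_cons_self, Nat.factorial_succ, pow_succ]
  have h3 : (i : ℂ) ≠ 0 := Nat.cast_ne_zero.2 hi
  have h4 : ((s.count i + 1 : ℕ) : ℂ) ≠ 0 := Nat.cast_ne_zero.2 (Nat.succ_ne_zero _)
  have h5 : ((s.count i).factorial : ℂ) ≠ 0 := Nat.cast_ne_zero.2 (Nat.factorial_ne_zero _)
  rw [Nat.cast_mul]
  field_simp

/-- Partitions with no part `i` contribute zero; removing one `i` maps the others bijectively onto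
the partitions of `n - i`. -/
theorem sum_count_mul_typeWeight (a : ℕ → ℂ) {i n : ℕ} (hi : i ≠ 0) (hin : i ≤ n) :
    ∑ p : n.Partition, (i : ℂ) * (p.parts.count i : ℂ) * typeWeight a p.parts =
      a i * ∑ q : (n - i).Partition, typeWeight a q.parts := by
  rw [Finset.mul_sum]
  symm
  refine Finset.sum_of_injOn
    (fun q : (n - i).Partition => (⟨i ::ₘ q.parts, fun {j} hj => by
      rcases Multiset.mem_cons.1 hj with rfl | hj
      · omega
      · exact q.parts_pos hj, by
      rw [Multiset.sum_cons, q.parts_sum]; omega⟩ : n.Partition)) ?_ ?_ ?_ ?_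
  · intro q _ q' _ h
    have h' := congrArg Nat.Partition.parts h
    exact Nat.Partition.ext ((Multiset.cons_inj_right i).1 h')
  · intro q _
    simp
  · intro p _ hp
    have : i ∉ p.parts := by
      intro hmem
      refine hp ⟨⟨p.parts.erase i, fun {j} hj => p.parts_pos (Multiset.mem_of_mem_erase hj), ?_⟩,
        by simp, ?_⟩
      · have h := p.parts_sum
        rw [← Multiset.cons_erase hmem, Multiset.sum_cons] at h
        omega
      · exact Nat.Partition.ext (Multiset.cons_erase hmem)
    simp [Multiset.count_eq_zero_of_notMem this]
  · intro q _
    exact (typeWeight_cons a hi q.parts).symm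

theorem cycleSum_zero (a : ℕ → ℂ) : cycleSum a 0 = 1 := by
  rw [cycleSum_eq_sum_typeWeight, Fintype.sum_unique]
  simp [typeWeight]

/-- The coefficient form of `H' = h' H`. Combinatorially, write the size of each partition as the
sum of `i * count i` and interchange the sums. -/
theorem succ_mul_cycleSum_succ (a : ℕ → ℂ) (n : ℕ) :
    ((n + 1 : ℕ) : ℂ) * cycleSum a (n + 1) =
      ∑ j ∈ Finset.range (n + 1), a (j + 1) * cycleSum a (n - j) := by
  have h1 : ∀ p : (n + 1).Partition, ((n + 1 : ℕ) : ℂ) =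
      ∑ j ∈ Finset.range (n + 1), ((j + 1 : ℕ) : ℂ) * (p.parts.count (j + 1) : ℂ) := by
    intro p
    have h := p.parts_sum
    rw [Finset.sum_multiset_count] at h
    have h2 : ∑ m ∈ p.parts.toFinset, (p.parts.count m • m) =
        ∑ m ∈ (Finset.range (n + 1)).image (· + 1), p.parts.count m • m := by
      refine Finset.sum_subset ?_ ?_
      · intro m hm
        have hm' := Multiset.mem_toFinset.1 hm
        have h2 := p.parts_pos hm'
        have h3 := Multiset.le_sum_of_mem hm'
        rw [p.parts_sum] at h3
        rw [Finset.mem_image]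
        exact ⟨m - 1, Finset.mem_range.2 (by omega), by omega⟩
      · intro m _ hm
        rw [Multiset.mem_toFinset] at hm
        simp [Multiset.count_eq_zero_of_notMem hm]
    rw [Finset.sum_image (by intro x _ y _ h; simpa using h)] at h2
    rw [h] at h2
    have h3 := congrArg (Nat.cast : ℕ → ℂ) h2
    rw [h3, Nat.cast_sum]
    exact Finset.sum_congr rfl fun j _ => by rw [smul_eq_mul, mul_comm, Nat.cast_mul]
  rw [cycleSum_eq_sum_typeWeight, Finset.mul_sum]
  rw [Finset.sum_congr rfl fun p _ => by rw [h1 p, Finset.sum_mul]]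
  rw [Finset.sum_comm]
  refine Finset.sum_congr rfl fun j hj => ?_
  have hj' := Finset.mem_range.1 hj
  rw [sum_count_mul_typeWeight a (Nat.succ_ne_zero j) (by omega), cycleSum_eq_sum_typeWeight,
    show n + 1 - (j + 1) = n - j by omega]

/-! ### Taylor coefficients and the exponential formula -/

/-- The `n`-th Taylor coefficient of `f` at the origin. -/
def taylorCoeff (f : ℂ → ℂ) (n : ℕ) : ℂ := iteratedDeriv n f 0 / (n.factorial : ℂ)

theorem iteratedDeriv_eq_factorial_mul_taylorCoeff (f : ℂ → ℂ) (n : ℕ) :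
    iteratedDeriv n f 0 = (n.factorial : ℂ) * taylorCoeff f n := by
  have : (n.factorial : ℂ) ≠ 0 := Nat.cast_ne_zero.2 n.factorial_ne_zero
  rw [taylorCoeff]
  field_simp

theorem hasFPowerSeriesAt_of_hasSum {f : ℂ → ℂ} {a : ℕ → ℂ}
    (h : ∀ᶠ t in 𝓝 (0 : ℂ), HasSum (fun k => a k * t ^ k) (f t)) :
    HasFPowerSeriesAt f (FormalMultilinearSeries.ofScalars ℂ a) 0 := by
  rw [hasFPowerSeriesAt_iff]
  filter_upwards [h] with t ht
  simpa [FormalMultilinearSeries.coeff_ofScalars, mul_comm] using ht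

theorem taylorCoeff_of_hasSum {f : ℂ → ℂ} {a : ℕ → ℂ}
    (h : ∀ᶠ t in 𝓝 (0 : ℂ), HasSum (fun k => a k * t ^ k) (f t)) (n : ℕ) :
    taylorCoeff f n = a n := by
  have h1 := hasFPowerSeriesAt_of_hasSum h
  have h2 := h1.analyticAt.hasFPowerSeriesAt
  have h3 := congrArg (fun p => FormalMultilinearSeries.coeff p n)
    (h1.eq_formalMultilinearSeries h2)
  simp only [FormalMultilinearSeries.coeff_ofScalars] at h3
  exact h3.symm

theorem taylorCoeff_sub {f g : ℂ → ℂ} (hf : AnalyticAt ℂ f 0) (hg : AnalyticAt ℂ g 0) (n : ℕ) :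
    taylorCoeff (fun z => f z - g z) n = taylorCoeff f n - taylorCoeff g n := by
  rw [taylorCoeff, iteratedDeriv_fun_sub hf.contDiffAt hg.contDiffAt, sub_div]
  rfl

theorem taylorCoeff_add {f g : ℂ → ℂ} (hf : AnalyticAt ℂ f 0) (hg : AnalyticAt ℂ g 0) (n : ℕ) :
    taylorCoeff (fun z => f z + g z) n = taylorCoeff f n + taylorCoeff g n := by
  rw [taylorCoeff, iteratedDeriv_fun_add hf.contDiffAt hg.contDiffAt, add_div]
  rfl

theorem taylorCoeff_const_mul (c : ℂ) (f : ℂ → ℂ) (n : ℕ) :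
    taylorCoeff (fun z => c * f z) n = c * taylorCoeff f n := by
  rw [taylorCoeff, iteratedDeriv_const_mul_field, mul_div_assoc]
  rfl

theorem taylorCoeff_const_succ (c : ℂ) (n : ℕ) :
    taylorCoeff (fun _ => c) (n + 1) = 0 := by
  simp [taylorCoeff, iteratedDeriv_const]

/-- Taylor coefficients of `exp ∘ h` satisfy the same recurrence as cycle sums. -/
theorem taylorCoeff_exp {h : ℂ → ℂ} {a : ℕ → ℂ} (hh : AnalyticAt ℂ h 0) (h0 : h 0 = 0)
    (ha : ∀ k : ℕ, ((k + 1 : ℕ) : ℂ) * taylorCoeff h (k + 1) = a (k + 1)) (n : ℕ) :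
    taylorCoeff (fun z => Complex.exp (h z)) n = cycleSum a n := by
  have hexp : AnalyticAt ℂ (fun z => Complex.exp (h z)) 0 := hh.cexp
  -- The Leibniz rule applied to this differential equation gives the recurrence of the cycle sums.
  have hderiv : deriv (fun z => Complex.exp (h z)) =ᶠ[𝓝 0]
      fun z => deriv h z * Complex.exp (h z) := by
    filter_upwards [hh.eventually_analyticAt] with z hz
    rw [deriv_cexp hz.differentiableAt, mul_comm]
  have hrec : ∀ n : ℕ, ((n + 1 : ℕ) : ℂ) * taylorCoeff (fun z => Complex.exp (h z)) (n + 1) =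
      ∑ j ∈ Finset.range (n + 1),
        a (j + 1) * taylorCoeff (fun z => Complex.exp (h z)) (n - j) := by
    intro n
    have hn : (n.factorial : ℂ) ≠ 0 := Nat.cast_ne_zero.2 n.factorial_ne_zero
    have hn1 : ((n + 1 : ℕ) : ℂ) ≠ 0 := Nat.cast_ne_zero.2 n.succ_ne_zero
    have h1 : ((n + 1 : ℕ) : ℂ) * taylorCoeff (fun z => Complex.exp (h z)) (n + 1) =
        iteratedDeriv n (fun z => deriv h z * Complex.exp (h z)) 0 / (n.factorial : ℂ) := by
      rw [taylorCoeff, iteratedDeriv_succ', hderiv.iteratedDeriv_eq, Nat.factorial_succ,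
        Nat.cast_mul]
      field_simp
    rw [h1, iteratedDeriv_fun_mul hh.deriv.contDiffAt hexp.contDiffAt, Finset.sum_div]
    refine Finset.sum_congr rfl fun j hj => ?_
    have hj' : j ≤ n := Nat.lt_succ_iff.1 (Finset.mem_range.1 hj)
    have hjf : (j.factorial : ℂ) ≠ 0 := Nat.cast_ne_zero.2 j.factorial_ne_zero
    rw [← iteratedDeriv_succ', iteratedDeriv_eq_factorial_mul_taylorCoeff,
      iteratedDeriv_eq_factorial_mul_taylorCoeff, ← ha, Nat.factorial_succ, Nat.cast_mul,
      ← Nat.choose_mul_factorial_mul_factorial hj']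
    have hc : (n.choose j : ℂ) ≠ 0 := Nat.cast_ne_zero.2 (Nat.choose_pos hj').ne'
    have hnj : ((n - j).factorial : ℂ) ≠ 0 := Nat.cast_ne_zero.2 (Nat.factorial_ne_zero _)
    push_cast
    field_simp
  induction n using Nat.strong_induction_on with
  | _ n ih =>
    cases n with
    | zero => simp [taylorCoeff, h0, cycleSum_zero]
    | succ n =>
      have hn1 : ((n + 1 : ℕ) : ℂ) ≠ 0 := Nat.cast_ne_zero.2 n.succ_ne_zero
      apply mul_left_cancel₀ hn1
      rw [hrec, succ_mul_cycleSum_succ]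
      refine Finset.sum_congr rfl fun j _ => ?_
      rw [ih (n - j) (by omega)]

/-! ### Transfer from singular behaviour to coefficient bounds -/

/-- On `|z| = ρ` the conjugate of `z` is `ρ² / z`, so the integrand becomes holomorphic apart from a
simple pole at `ρ²`, and Cauchy's formula for `(1 - z)⁻¹` at that point gives the value. -/
theorem integral_inv_norm_one_sub_circleMap_sq {ρ : ℝ} (h0 : 0 < ρ) (h1 : ρ < 1) :
    ∫ θ in (0 : ℝ)..2 * Real.pi, (‖1 - circleMap 0 ρ θ‖ ^ 2)⁻¹ =
      2 * Real.pi * (1 - ρ ^ 2)⁻¹ := by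
  have hd : DiffContOnCl ℂ (fun z : ℂ => (1 - z)⁻¹) (Metric.ball 0 ρ) := by
    refine DifferentiableOn.diffContOnCl_ball (U := Metric.ball 0 1) ?_
      (Metric.closedBall_subset_ball h1)
    intro z hz
    have : (1 : ℂ) - z ≠ 0 := by
      intro h
      have : z = 1 := (sub_eq_zero.1 h).symm
      simp [this] at hz
    exact (((differentiableAt_const _).sub differentiableAt_id).inv this).differentiableWithinAt
  have hw : ((ρ ^ 2 : ℝ) : ℂ) ∈ Metric.ball (0 : ℂ) ρ := by
    rw [mem_ball_zero_iff, Complex.norm_real, Real.norm_of_nonneg (by positivity)]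
    nlinarith
  have key := hd.circleIntegral_sub_inv_smul hw
  have hpt : ∀ θ : ℝ, deriv (circleMap 0 ρ) θ •
      ((circleMap 0 ρ θ - ((ρ ^ 2 : ℝ) : ℂ))⁻¹ • (1 - circleMap 0 ρ θ)⁻¹) =
      Complex.I * (((‖1 - circleMap 0 ρ θ‖ ^ 2)⁻¹ : ℝ) : ℂ) := by
    intro θ
    set z := circleMap 0 ρ θ with hz
    have hzn : ‖z‖ = ρ := by simp [hz, abs_of_pos h0]
    have hz0 : z ≠ 0 := by rw [← norm_pos_iff, hzn]; exact h0
    have hz1 : (1 : ℂ) - z ≠ 0 := by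
      intro h
      rw [← sub_eq_zero.1 h] at hzn
      simp at hzn
      exact h1.ne hzn.symm
    have hsq : ((ρ ^ 2 : ℝ) : ℂ) = z * (starRingEnd ℂ) z := by
      rw [Complex.mul_conj, Complex.normSq_eq_norm_sq, hzn]
    have hn : ((‖1 - z‖ ^ 2 : ℝ) : ℂ) = (1 - z) * (1 - (starRingEnd ℂ) z) := by
      rw [← Complex.normSq_eq_norm_sq, ← Complex.mul_conj]
      simp
    have hc1 : (1 : ℂ) - (starRingEnd ℂ) z ≠ 0 := by
      have := (map_ne_zero (starRingEnd ℂ)).2 hz1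
      simpa using this
    rw [deriv_circleMap, ← hz, Complex.ofReal_inv, hn, hsq,
      show z - z * (starRingEnd ℂ) z = z * (1 - (starRingEnd ℂ) z) by ring]
    simp only [smul_eq_mul]
    field_simp
  rw [circleIntegral] at key
  simp_rw [hpt] at key
  rw [intervalIntegral.integral_const_mul, intervalIntegral.integral_ofReal, smul_eq_mul,
    mul_comm (2 * (Real.pi : ℂ)) Complex.I, mul_assoc] at key
  have := mul_left_cancel₀ Complex.I_ne_zero key
  exact_mod_cast this

/-- If `g` is dominated by `A ‖1 - t‖ ^ (-a) + B` in the unit disc, then its Taylor coefficients are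
dominated by `A (n + 1) ^ (a - 1) + B`. -/
theorem norm_iteratedDeriv_zero_le {g : ℂ → ℂ} (hg : DifferentiableOn ℂ g (Metric.ball 0 1))
    {A B a : ℝ} (hA : 0 ≤ A) (hB : 0 ≤ B) (ha : 2 ≤ a)
    (hbd : ∀ t : ℂ, ‖t‖ < 1 → ‖g t‖ ≤ A * ‖1 - t‖ ^ (-a) + B) {n : ℕ} (hn : 1 ≤ n) :
    ‖iteratedDeriv n g 0‖ ≤ n.factorial * (3 * (A * ((n : ℝ) + 1) ^ (a - 1) + B)) := by
  have hn0 : (0 : ℝ) < n := by exact_mod_cast hn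
  -- This radius gives `1 - ρ = 1 / (n + 1)` while `ρ ^ (-n) ≤ e`.
  set ρ : ℝ := n / (n + 1) with hρ
  have hρ0 : 0 < ρ := by positivity
  have hρ1 : 1 - ρ = ((n : ℝ) + 1)⁻¹ := by rw [hρ]; field_simp; ring
  have hρlt : ρ < 1 := by
    have : 0 < 1 - ρ := by rw [hρ1]; positivity
    linarith
  have hcauchy := DiffContOnCl.circleIntegral_one_div_sub_center_pow_smul hρ0 n
    (hg.diffContOnCl_ball (Metric.closedBall_subset_ball hρlt))
  have hnorm : ∀ θ : ℝ, ‖circleMap 0 ρ θ‖ = ρ := fun θ => by simp [abs_of_pos hρ0]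
  have hdist : ∀ θ : ℝ, 1 - ρ ≤ ‖1 - circleMap 0 ρ θ‖ := fun θ => by
    have := norm_sub_norm_le (1 : ℂ) (circleMap 0 ρ θ)
    rwa [norm_one, hnorm] at this
  have hpos : ∀ θ : ℝ, 0 < ‖1 - circleMap 0 ρ θ‖ := fun θ => by linarith [hdist θ]
  have hpt : ∀ θ : ℝ, ‖deriv (circleMap 0 ρ) θ •
      ((1 / (circleMap 0 ρ θ - 0) ^ (n + 1)) • g (circleMap 0 ρ θ))‖ ≤
      (ρ ^ n)⁻¹ * (A * (1 - ρ) ^ (2 - a)) * (‖1 - circleMap 0 ρ θ‖ ^ 2)⁻¹ + (ρ ^ n)⁻¹ * B := by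
    intro θ
    have h1 : ‖1 - circleMap 0 ρ θ‖ ^ (-a) ≤
        (1 - ρ) ^ (2 - a) * (‖1 - circleMap 0 ρ θ‖ ^ 2)⁻¹ := by
      -- Since `a ≥ 2`, the power `2 - a` is largest at the point nearest to `1`; the remaining
      -- inverse square is integrated exactly.
      rw [show -a = (2 - a) + (-2 : ℝ) by ring, Real.rpow_add (hpos θ), Real.rpow_neg (hpos θ).le,
        Real.rpow_two]
      refine mul_le_mul_of_nonneg_right ?_ (by positivity)
      exact Real.rpow_le_rpow_of_nonpos (by linarith) (hdist θ) (by linarith)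
    have h2 := hbd (circleMap 0 ρ θ) (by rw [hnorm]; exact hρlt)
    have h3 : ‖g (circleMap 0 ρ θ)‖ ≤
        A * ((1 - ρ) ^ (2 - a) * (‖1 - circleMap 0 ρ θ‖ ^ 2)⁻¹) + B :=
      h2.trans (by gcongr)
    rw [norm_smul, norm_smul, deriv_circleMap, norm_mul, Complex.norm_I, sub_zero, norm_div,
      norm_one, norm_pow, hnorm, mul_one, ← mul_assoc]
    have h4 : ρ * (1 / ρ ^ (n + 1)) = (ρ ^ n)⁻¹ := by field_simp; ring
    rw [h4]
    calc (ρ ^ n)⁻¹ * ‖g (circleMap 0 ρ θ)‖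
        ≤ (ρ ^ n)⁻¹ * (A * ((1 - ρ) ^ (2 - a) * (‖1 - circleMap 0 ρ θ‖ ^ 2)⁻¹) + B) := by gcongr
      _ = _ := by ring
  have hcont : Continuous fun θ : ℝ => (‖1 - circleMap 0 ρ θ‖ ^ 2)⁻¹ := by
    refine Continuous.inv₀ ?_ fun θ => (pow_pos (hpos θ) 2).ne'
    exact ((continuous_const.sub (continuous_circleMap 0 ρ)).norm).pow 2
  have hint : ‖∮ z in C(0, ρ), (1 / (z - 0) ^ (n + 1)) • g z‖ ≤
      (ρ ^ n)⁻¹ * (A * (1 - ρ) ^ (2 - a)) * (2 * Real.pi * (1 - ρ ^ 2)⁻¹) +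
        2 * Real.pi * ((ρ ^ n)⁻¹ * B) := by
    rw [circleIntegral]
    have hi1 : IntervalIntegrable (fun θ : ℝ => (ρ ^ n)⁻¹ * (A * (1 - ρ) ^ (2 - a)) *
        (‖1 - circleMap 0 ρ θ‖ ^ 2)⁻¹) volume 0 (2 * Real.pi) :=
      (continuous_const.mul hcont).intervalIntegrable _ _
    have hi2 : IntervalIntegrable (fun _ : ℝ => (ρ ^ n)⁻¹ * B) volume 0 (2 * Real.pi) :=
      continuous_const.intervalIntegrable _ _
    refine (intervalIntegral.norm_integral_le_of_norm_le (by positivity)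
      (Eventually.of_forall fun θ _ => hpt θ) (hi1.add hi2)).trans ?_
    rw [intervalIntegral.integral_add hi1 hi2, intervalIntegral.integral_const_mul,
      integral_inv_norm_one_sub_circleMap_sq hρ0 hρlt, intervalIntegral.integral_const]
    simp
  rw [hcauchy, norm_smul] at hint
  have hnf : (0 : ℝ) < n.factorial := by exact_mod_cast n.factorial_pos
  have hc : ‖(2 * (Real.pi : ℂ) * Complex.I / (n.factorial : ℂ))‖ =
      2 * Real.pi / n.factorial := by
    simp [abs_of_pos Real.pi_pos]
  rw [hc] at hint
  have hρn : (ρ ^ n)⁻¹ ≤ 3 := by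
    have h1 : (ρ⁻¹) ≤ Real.exp ((n : ℝ)⁻¹) := by
      have := Real.add_one_le_exp ((n : ℝ)⁻¹)
      refine le_trans (le_of_eq ?_) this
      rw [hρ]; field_simp; ring
    rw [← inv_pow]
    calc (ρ⁻¹) ^ n ≤ (Real.exp ((n : ℝ)⁻¹)) ^ n := by gcongr
      _ = Real.exp 1 := by rw [← Real.exp_nat_mul, mul_inv_cancel₀ hn0.ne']
      _ ≤ 3 := by linarith [Real.exp_one_lt_d9]
  have h5 : (1 - ρ) ^ (2 - a) * (1 - ρ ^ 2)⁻¹ ≤ ((n : ℝ) + 1) ^ (a - 1) := by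
    have h6 : (1 - ρ ^ 2)⁻¹ ≤ (1 - ρ)⁻¹ := by
      apply inv_anti₀ (by linarith)
      nlinarith
    have hpos' : 0 < 1 - ρ := by linarith
    calc (1 - ρ) ^ (2 - a) * (1 - ρ ^ 2)⁻¹ ≤ (1 - ρ) ^ (2 - a) * (1 - ρ)⁻¹ := by gcongr
      _ = (1 - ρ) ^ (2 - a - 1) := by rw [Real.rpow_sub_one hpos'.ne']; rfl
      _ = ((n : ℝ) + 1) ^ (a - 1) := by
        rw [hρ1, Real.inv_rpow (by positivity), ← Real.rpow_neg (by positivity)]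
        congr 1; ring
  have h7 : ‖iteratedDeriv n g 0‖ ≤ n.factorial *
      ((ρ ^ n)⁻¹ * (A * ((1 - ρ) ^ (2 - a) * (1 - ρ ^ 2)⁻¹) + B)) := by
    have hpi := Real.pi_pos
    have h8 : 2 * Real.pi / n.factorial * ‖iteratedDeriv n g 0‖ ≤ 2 * Real.pi / n.factorial *
        (n.factorial * ((ρ ^ n)⁻¹ * (A * ((1 - ρ) ^ (2 - a) * (1 - ρ ^ 2)⁻¹) + B))) := by
      refine hint.trans (le_of_eq ?_)
      field_simp
    exact le_of_mul_le_mul_left h8 (by positivity)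
  refine h7.trans ?_
  have h9 : (0 : ℝ) ≤ ((n : ℝ) + 1) ^ (a - 1) := by positivity
  have h10 : 0 ≤ 1 - ρ := by linarith
  have h11 : 0 ≤ (1 - ρ ^ 2)⁻¹ := inv_nonneg.2 (by nlinarith)
  have h12 : 0 ≤ (1 - ρ) ^ (2 - a) := by positivity
  gcongr

theorem rpow_le_of_ratio_le {x y q e : ℝ} (hx : 0 < x) (hy : 0 < y) (hq : 1 ≤ q)
    (h1 : x ≤ q * y) (h2 : y ≤ q * x) : x ^ e ≤ q ^ |e| * y ^ e := by
  have hq0 : 0 < q := by linarith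
  rcases le_total 0 e with he | he
  · rw [abs_of_nonneg he, ← Real.mul_rpow hq0.le hy.le]
    exact Real.rpow_le_rpow hx.le h1 he
  · rw [abs_of_nonpos he, Real.rpow_neg hq0.le, ← Real.inv_rpow hq0.le,
      ← Real.mul_rpow (by positivity) hy.le]
    refine Real.rpow_le_rpow_of_nonpos (by positivity) ?_ he
    rw [inv_mul_le_iff₀ hq0]
    exact h2

/-- The disc `‖z‖ ≤ 1`, enlarged by a neighbourhood of every boundary point except `1`. -/
def indentedDisc (c : ℝ) : Set ℂ := {z | ‖z‖ ≤ 1 + c * ‖1 - z‖}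

theorem ball_subset_indentedDisc {c : ℝ} (hc : 0 ≤ c) :
    Metric.ball (0 : ℂ) 1 ⊆ indentedDisc c \ {1} := by
  intro z hz
  rw [mem_ball_zero_iff] at hz
  refine ⟨?_, ?_⟩
  · have : 0 ≤ c * ‖1 - z‖ := by positivity
    change ‖z‖ ≤ _
    linarith
  · rintro rfl
    simp at hz

/-- Provides room for Cauchy's estimate: a circle about `t` of radius proportional to `|1 - t|`
stays in the region, and `|1 - z|` is comparable to `|1 - t|` along it. -/
theorem mem_indentedDisc_of_dist_le {c δ : ℝ} (hc0 : 0 < c) (hc1 : c ≤ 1) {t z : ℂ}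
    (ht : ‖t‖ < 1) (hδ : δ ≤ c / 4 * ‖1 - t‖) (hz : ‖z - t‖ ≤ δ) :
    z ∈ indentedDisc c \ {1} ∧ ‖1 - z‖ ≤ 2 * ‖1 - t‖ ∧ ‖1 - t‖ ≤ 2 * ‖1 - z‖ ∧
      ‖z‖ ≤ 1 + δ := by
  have hpos : 0 < ‖1 - t‖ := by
    have := norm_sub_norm_le (1 : ℂ) t
    rw [norm_one] at this
    linarith
  have h1 : ‖1 - z‖ ≤ ‖1 - t‖ + ‖z - t‖ := by
    have := norm_sub_le (1 - t) (z - t)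
    rwa [show 1 - t - (z - t) = 1 - z by ring] at this
  have h2 : ‖1 - t‖ ≤ ‖1 - z‖ + ‖z - t‖ := by
    have := norm_add_le (1 - z) (z - t)
    rwa [show 1 - z + (z - t) = 1 - t by ring] at this
  have h3 : ‖z‖ ≤ ‖t‖ + ‖z - t‖ := by
    have := norm_add_le t (z - t)
    rwa [show t + (z - t) = z by ring] at this
  have h4 : c * ‖1 - t‖ ≤ ‖1 - t‖ := by nlinarith
  have h5 : ‖1 - t‖ ≤ 2 * ‖1 - z‖ := by linarith
  refine ⟨⟨?_, ?_⟩, by linarith, h5, by linarith⟩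
  · change ‖z‖ ≤ 1 + c * ‖1 - z‖
    nlinarith
  · intro h
    rw [Set.mem_singleton_iff.1 h, sub_self, norm_zero] at h5
    linarith

/-- Cauchy's estimate with radius `(c/4)|1 - t|` near `1` and `c/(8M)` elsewhere, costing `|1 -
t|^{-k}` and `M^k` respectively. Splitting at `1/(2M)` leaves a factor two on either side, so each
circle stays where its hypothesis applies. -/
theorem norm_iteratedDeriv_le_of_indentedDisc {c : ℝ} (hc0 : 0 < c) (hc1 : c ≤ 1) (b : ℝ) (k : ℕ)
    {U : Set ℂ} {f : ℂ → ℂ} {M A B : ℝ} (hM : 1 ≤ M) (hA : 0 ≤ A) (hB : 0 ≤ B)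
    (hf : DifferentiableOn ℂ f U) (hU : indentedDisc c \ {1} ⊆ U)
    (hnear : ∀ z ∈ indentedDisc c \ {1}, ‖1 - z‖ ≤ 1 / M → ‖f z‖ ≤ A * ‖1 - z‖ ^ (-b))
    (hfar : ∀ z ∈ indentedDisc c \ {1}, ‖z‖ ≤ 1 + 1 / M → 1 / (4 * M) ≤ ‖1 - z‖ → ‖f z‖ ≤ B)
    {t : ℂ} (ht : ‖t‖ < 1) :
    ‖iteratedDeriv k f t‖ ≤
      k.factorial * (4 / c) ^ k * 2 ^ |b| * A * ‖1 - t‖ ^ (-(b + k)) +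
        k.factorial * (8 / c) ^ k * (B * M ^ k) := by
  have hpos : 0 < ‖1 - t‖ := by
    have := norm_sub_norm_le (1 : ℂ) t
    rw [norm_one] at this
    linarith
  have hM0 : 0 < M := by linarith
  rcases le_or_gt ‖1 - t‖ (1 / (2 * M)) with hcase | hcase
  · have hδ : 0 < c / 4 * ‖1 - t‖ := by positivity
    have hball : ∀ z ∈ Metric.closedBall t (c / 4 * ‖1 - t‖), _ := fun z hz =>
      mem_indentedDisc_of_dist_le hc0 hc1 ht le_rfl (mem_closedBall_iff_norm.1 hz)
    have h1 := Complex.norm_iteratedDeriv_le_of_forall_mem_sphere_norm_le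
      (C := 2 ^ |b| * A * ‖1 - t‖ ^ (-b)) k hδ
      (hf.diffContOnCl_ball fun z hz => hU (hball z hz).1) (fun z hz => by
        obtain ⟨hz1, hz2, hz3, -⟩ := hball z (Metric.sphere_subset_closedBall hz)
        have h2 : ‖1 - z‖ ≤ 1 / M := by
          have : 1 / M = 2 * (1 / (2 * M)) := by field_simp
          linarith
        refine (hnear z hz1 h2).trans ?_
        have h3 := rpow_le_of_ratio_le (e := -b) (by linarith) hpos one_le_two hz2 hz3
        rw [abs_neg] at h3
        calc A * ‖1 - z‖ ^ (-b) ≤ A * (2 ^ |b| * ‖1 - t‖ ^ (-b)) := by gcongr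
          _ = _ := by ring)
    refine h1.trans ?_
    have h4 : k.factorial * (2 ^ |b| * A * ‖1 - t‖ ^ (-b)) / (c / 4 * ‖1 - t‖) ^ k =
        k.factorial * (4 / c) ^ k * 2 ^ |b| * A * ‖1 - t‖ ^ (-(b + k)) := by
      rw [neg_add, Real.rpow_add hpos, Real.rpow_neg hpos.le (k : ℝ), Real.rpow_natCast, mul_pow,
        div_pow, div_pow]
      field_simp
    rw [h4]
    have : 0 ≤ k.factorial * (8 / c) ^ k * (B * M ^ k) := by positivity
    linarith
  · have hδ : 0 < c / 4 * (1 / (2 * M)) := by positivity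
    have hball : ∀ z ∈ Metric.closedBall t (c / 4 * (1 / (2 * M))), _ := fun z hz =>
      mem_indentedDisc_of_dist_le hc0 hc1 ht (by gcongr) (mem_closedBall_iff_norm.1 hz)
    have h1 := Complex.norm_iteratedDeriv_le_of_forall_mem_sphere_norm_le
      (C := B) k hδ
      (hf.diffContOnCl_ball fun z hz => hU (hball z hz).1) (fun z hz => by
        obtain ⟨hz1, hz2, hz3, hz4⟩ := hball z (Metric.sphere_subset_closedBall hz)
        refine hfar z hz1 (hz4.trans ?_) ?_
        · have h2 : c / 4 * (1 / (2 * M)) ≤ 1 / M := by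
            rw [show c / 4 * (1 / (2 * M)) = (c / 8) * (1 / M) by field_simp; norm_num]
            have : 0 < 1 / M := by positivity
            nlinarith
          linarith
        · have : 1 / (2 * M) = 2 * (1 / (4 * M)) := by field_simp; norm_num
          linarith)
    refine h1.trans ?_
    have h4 : k.factorial * B / (c / 4 * (1 / (2 * M))) ^ k =
        k.factorial * (8 / c) ^ k * (B * M ^ k) := by
      rw [show c / 4 * (1 / (2 * M)) = c / (8 * M) by field_simp; norm_num, div_pow, div_pow,
        mul_pow]
      field_simp
    rw [h4]
    have : 0 ≤ k.factorial * (4 / c) ^ k * 2 ^ |b| * A * ‖1 - t‖ ^ (-(b + k)) := by positivity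
    linarith

/-- Transfer from bounds on an indented disc to Taylor coefficients, with a separate bound away
from the singularity that only has to hold for `‖z‖ ≤ 1 + 1 / M`. -/
theorem norm_taylorCoeff_le_of_indentedDisc {c : ℝ} (hc0 : 0 < c) (hc1 : c ≤ 1) (b : ℝ) (k : ℕ)
    (hbk : 2 ≤ b + k) :
    ∃ C : ℝ, 0 < C ∧ ∀ (U : Set ℂ) (f : ℂ → ℂ) (M A B : ℝ), 1 ≤ M → 0 ≤ A → 0 ≤ B →
      DifferentiableOn ℂ f U → indentedDisc c \ {1} ⊆ U →
      (∀ z ∈ indentedDisc c \ {1}, ‖1 - z‖ ≤ 1 / M → ‖f z‖ ≤ A * ‖1 - z‖ ^ (-b)) →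
      (∀ z ∈ indentedDisc c \ {1}, ‖z‖ ≤ 1 + 1 / M → 1 / (4 * M) ≤ ‖1 - z‖ → ‖f z‖ ≤ B) →
      ∀ N : ℕ, k + 1 ≤ N →
        ‖taylorCoeff f N‖ ≤ C * (A * (N : ℝ) ^ (b - 1) + B * (M / N) ^ k) := by
  set q : ℝ := (k : ℝ) + 2 with hq
  have hq0 : 1 ≤ q := by rw [hq]; linarith [Nat.cast_nonneg (α := ℝ) k]
  set C₁ : ℝ := k.factorial * (4 / c) ^ k * 2 ^ |b| with hC₁
  set C₂ : ℝ := k.factorial * (8 / c) ^ k with hC₂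
  have hC₁0 : 0 < C₁ := by positivity
  have hC₂0 : 0 < C₂ := by positivity
  refine ⟨3 * (C₁ * q ^ |b - 1| + C₂ * q ^ k), by positivity, ?_⟩
  intro U f M A B hM hA hB hf hU hnear hfar N hN
  -- Passing to the `k`-th derivative raises the exponent to `b + k ≥ 2`. Since `(n + k)! ≥ n! (n +
  -- 1)^k`, the coefficient of `f` recovers a factor `(n + 1)^{-k}`, which restores the exponent `b
  -- - 1` near `1` and turns `M^k` into `(M/N)^k` elsewhere.
  obtain ⟨n, rfl⟩ : ∃ n, N = n + k := ⟨N - k, by omega⟩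
  have hn : 1 ≤ n := by omega
  have hM0 : 0 < M := by linarith
  have hfb : DifferentiableOn ℂ f (Metric.ball 0 1) :=
    hf.mono ((ball_subset_indentedDisc hc0.le).trans hU)
  have hg : DifferentiableOn ℂ (iteratedDeriv k f) (Metric.ball 0 1) := by
    rw [iteratedDeriv_eq_iterate]
    exact ((hfb.analyticOnNhd Metric.isOpen_ball).iterated_deriv k).differentiableOn
  have h1 := norm_iteratedDeriv_zero_le hg (A := C₁ * A) (B := C₂ * (B * M ^ k)) (a := b + k)
    (by positivity) (by positivity) hbk
    (fun t ht => norm_iteratedDeriv_le_of_indentedDisc hc0 hc1 b k hM hA hB hf hU hnear hfar ht) hn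
  have h2 : iteratedDeriv n (iteratedDeriv k f) 0 = iteratedDeriv (n + k) f 0 := by
    simp only [iteratedDeriv_eq_iterate, Function.iterate_add_apply]
  rw [h2] at h1
  have hn1 : (0 : ℝ) < (n : ℝ) + 1 := by positivity
  have hfac : (n.factorial : ℝ) * ((n : ℝ) + 1) ^ k ≤ (n + k).factorial := by
    exact_mod_cast Nat.factorial_mul_pow_le_factorial (m := n) (n := k)
  have hNf : (0 : ℝ) < (n + k).factorial := by exact_mod_cast Nat.factorial_pos _
  have hnf : (0 : ℝ) < n.factorial := by exact_mod_cast Nat.factorial_pos _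
  set N : ℝ := ((n + k : ℕ) : ℝ) with hNdef
  have hNpos : 0 < N := by rw [hNdef]; exact_mod_cast (by omega : 0 < n + k)
  have hnr : (1 : ℝ) ≤ n := by exact_mod_cast hn
  have hk0 : (0 : ℝ) ≤ k := Nat.cast_nonneg k
  have hr1 : (n : ℝ) + 1 ≤ q * N := by
    rw [hq, hNdef]; push_cast; nlinarith
  have hr2 : N ≤ q * ((n : ℝ) + 1) := by
    rw [hq, hNdef]; push_cast; nlinarith
  set X := 3 * (C₁ * A * ((n : ℝ) + 1) ^ (b + k - 1) + C₂ * (B * M ^ k)) with hX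
  have hX0 : 0 ≤ X := by positivity
  have h3 : ‖taylorCoeff f (n + k)‖ ≤ X / ((n : ℝ) + 1) ^ k := by
    rw [taylorCoeff, norm_div, Complex.norm_natCast, div_le_div_iff₀ hNf (by positivity)]
    calc ‖iteratedDeriv (n + k) f 0‖ * ((n : ℝ) + 1) ^ k
        ≤ (n.factorial * X) * ((n : ℝ) + 1) ^ k := by gcongr
      _ = X * (n.factorial * ((n : ℝ) + 1) ^ k) := by ring
      _ ≤ X * (n + k).factorial := by gcongr
  have h4 : X / ((n : ℝ) + 1) ^ k =
      3 * (C₁ * A * ((n : ℝ) + 1) ^ (b - 1) + C₂ * B * (M / ((n : ℝ) + 1)) ^ k) := by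
    rw [hX, show b + k - 1 = (b - 1) + k by ring, Real.rpow_add hn1, Real.rpow_natCast, div_pow]
    field_simp
  have h5 := rpow_le_of_ratio_le (e := b - 1) hn1 hNpos hq0 hr1 hr2
  have h6 : (M / ((n : ℝ) + 1)) ^ k ≤ q ^ k * (M / N) ^ k := by
    rw [← mul_pow]
    gcongr
    rw [mul_div_assoc', div_le_div_iff₀ hn1 hNpos]
    nlinarith
  rw [h4] at h3
  refine h3.trans ?_
  have h7 : 0 ≤ N ^ (b - 1) := by positivity
  have h8 : 0 ≤ (M / N) ^ k := by positivity
  have hqa : 0 < q ^ |b - 1| := by positivity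
  calc 3 * (C₁ * A * ((n : ℝ) + 1) ^ (b - 1) + C₂ * B * (M / ((n : ℝ) + 1)) ^ k)
      ≤ 3 * (C₁ * A * (q ^ |b - 1| * N ^ (b - 1)) + C₂ * B * (q ^ k * (M / N) ^ k)) := by gcongr
    _ ≤ 3 * (C₁ * q ^ |b - 1| + C₂ * q ^ k) * (A * N ^ (b - 1) + B * (M / N) ^ k) := by
        have e1 : 0 ≤ C₁ * q ^ |b - 1| * (B * (M / N) ^ k) := by positivity
        have e2 : 0 ≤ C₂ * q ^ k * (A * N ^ (b - 1)) := by positivity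
        have e3 : 3 * (C₁ * q ^ |b - 1| + C₂ * q ^ k) * (A * N ^ (b - 1) + B * (M / N) ^ k) =
            3 * (C₁ * A * (q ^ |b - 1| * N ^ (b - 1)) + C₂ * B * (q ^ k * (M / N) ^ k)) +
              3 * (C₁ * q ^ |b - 1| * (B * (M / N) ^ k) +
                C₂ * q ^ k * (A * N ^ (b - 1))) := by ring
        rw [e3]
        linarith

/-! ### Functions with a logarithmic singularity at `1` -/

theorem norm_le_of_mem_indentedDisc {c : ℝ} (hc : c ≤ 1 / 4) {z : ℂ} (hz : z ∈ indentedDisc c) :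
    ‖z‖ ≤ 2 ∧ ‖1 - z‖ ≤ 3 := by
  have h1 : ‖z‖ ≤ 1 + c * ‖1 - z‖ := hz
  have h2 : ‖1 - z‖ ≤ 1 + ‖z‖ := by simpa using norm_sub_le (1 : ℂ) z
  have h3 : c * ‖1 - z‖ ≤ 1 / 4 * ‖1 - z‖ := by gcongr
  constructor <;> linarith

/-- In the excluded cone `Re (z - 1) ≥ cos φ |z - 1|`, hence `|z|² ≥ 1 + 2 cos φ |z - 1| + |z -
1|²`, which exceeds `(1 + c|z - 1|)²` once `2c ≤ cos φ`. The bound `c ≤ (R - 1)/6` keeps `|z| < R`,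
because `|1 - z| ≤ 3`. -/
theorem exists_indentedDisc_subset_deltaDomain {R φ : ℝ} (hR : 1 < R) (hφ0 : 0 < φ)
    (hφ : φ < Real.pi / 2) :
    ∃ c : ℝ, 0 < c ∧ c ≤ 1 / 4 ∧ indentedDisc c \ {1} ⊆ deltaDomain 1 R φ := by
  have hcos : 0 < Real.cos φ := Real.cos_pos_of_mem_Ioo ⟨by linarith [Real.pi_pos], hφ⟩
  set c : ℝ := min (1 / 4) (min (Real.cos φ / 2) ((R - 1) / 6)) with hc
  have hc0 : 0 < c := lt_min (by norm_num) (lt_min (by positivity) (by linarith))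
  have hc1 : c ≤ 1 / 4 := min_le_left _ _
  have hc2 : c ≤ Real.cos φ / 2 := (min_le_right _ _).trans (min_le_left _ _)
  have hc3 : c ≤ (R - 1) / 6 := (min_le_right _ _).trans (min_le_right _ _)
  refine ⟨c, hc0, hc1, ?_⟩
  rintro z ⟨hz, hz1⟩
  have hz' : ‖z‖ ≤ 1 + c * ‖1 - z‖ := hz
  have hne : z ≠ 1 := hz1
  have hpos : 0 < ‖z - 1‖ := norm_pos_iff.2 (sub_ne_zero.2 hne)
  have hbd := (norm_le_of_mem_indentedDisc hc1 hz).2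
  rw [norm_sub_rev] at hz' hbd
  refine ⟨by nlinarith, by simpa using hne, ?_⟩
  rw [Complex.ofReal_one]
  by_contra hcon
  push Not at hcon
  have h1 : Real.cos φ ≤ Real.cos (Complex.arg (z - 1)) := by
    rw [← Real.cos_abs (Complex.arg (z - 1))]
    exact Real.cos_le_cos_of_nonneg_of_le_pi (abs_nonneg _) (by linarith [Real.pi_pos]) hcon
  have h2 := Complex.norm_mul_cos_arg (z - 1)
  have h3 : ‖z‖ ^ 2 = 1 + 2 * (z - 1).re + ‖z - 1‖ ^ 2 := by
    rw [Complex.sq_norm, Complex.sq_norm, Complex.normSq_apply, Complex.normSq_apply]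
    simp only [Complex.sub_re, Complex.sub_im, Complex.one_re, Complex.one_im]
    ring
  have h4 : ‖z‖ ^ 2 ≤ (1 + c * ‖z - 1‖) ^ 2 := by gcongr
  have h5 : Real.cos φ * ‖z - 1‖ ≤ (z - 1).re := by rw [← h2, mul_comm]; gcongr
  have h6 : 2 * c * ‖z - 1‖ ≤ Real.cos φ * ‖z - 1‖ := by
    have := mul_le_mul_of_nonneg_right hc2 hpos.le
    linarith
  have h7 : 0 < c * ‖z - 1‖ := by positivity
  have h8 : (c * ‖z - 1‖) ^ 2 ≤ ‖z - 1‖ ^ 2 := by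
    have : c * ‖z - 1‖ ≤ ‖z - 1‖ := by nlinarith
    gcongr
  nlinarith

theorem one_sub_mem_slitPlane_of_mem_deltaDomain {R φ : ℝ} (hφ : 0 < φ) {z : ℂ}
    (hz : z ∈ deltaDomain 1 R φ) : 1 - z ∈ Complex.slitPlane := by
  obtain ⟨-, -, h⟩ := hz
  rw [Complex.mem_slitPlane_iff]
  by_contra hcon
  push Not at hcon
  obtain ⟨h1, h2⟩ := hcon
  have : Complex.arg (z - ((1 : ℝ) : ℂ)) = 0 := by
    rw [Complex.arg_eq_zero_iff]
    simp at h1 h2 ⊢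
    exact ⟨h1, h2⟩
  rw [this, abs_zero] at h
  linarith

/-- `G` is holomorphic on a neighbourhood `U` of a punctured indented disc and behaves like
`-ϑ log (1 - z) + K` there, up to `O(1 - z)`. -/
structure LogSingular (G : ℂ → ℂ) (ϑ K c C : ℝ) (U : Set ℂ) : Prop where
  c_pos : 0 < c
  c_le : c ≤ 1 / 4
  C_pos : 0 < C
  subset : indentedDisc c \ {1} ⊆ U
  slit : ∀ z ∈ U, 1 - z ∈ Complex.slitPlane
  diff : DifferentiableOn ℂ G U
  bound : ∀ z ∈ indentedDisc c \ {1}, ‖G z + ϑ * Complex.log (1 - z) - K‖ ≤ C * ‖1 - z‖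

/-- The local `O(1 - z)` becomes a bound on the whole punctured indented disc: away from `1` that
set is compact, so the remainder is bounded there and `|1 - z|` is bounded below. -/
theorem exists_logSingular {G : ℂ → ℂ} {ϑ K : ℝ} (hG : G ∈ functionClass 1 ϑ K) :
    ∃ (c C : ℝ) (U : Set ℂ), LogSingular G ϑ K c C U := by
  obtain ⟨R, φ, hR, hφ0, hφ, hdiff, hO⟩ := hG
  obtain ⟨c, hc0, hc1, hsub⟩ := exists_indentedDisc_subset_deltaDomain hR hφ0 hφ
  have hslit : ∀ z ∈ deltaDomain 1 R φ, 1 - z ∈ Complex.slitPlane := fun z hz =>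
    one_sub_mem_slitPlane_of_mem_deltaDomain hφ0 hz
  obtain ⟨C₁, hC₁⟩ := Asymptotics.isBigO_iff.1 hO
  rw [eventually_nhdsWithin_iff, Metric.eventually_nhds_iff] at hC₁
  obtain ⟨δ, hδ, hC₁⟩ := hC₁
  set D : ℂ → ℂ := fun z => G z + ϑ * Complex.log (1 - z) - K with hD
  have hcont : ContinuousOn D (deltaDomain 1 R φ) := by
    refine (hdiff.continuousOn.add (continuousOn_const.mul ?_)).sub continuousOn_const
    exact (continuousOn_const.sub continuousOn_id).clog hslit
  have hclosed : IsClosed (indentedDisc c ∩ {z | δ ≤ ‖1 - z‖}) := by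
    refine IsClosed.inter ?_ ?_
    · exact isClosed_le continuous_norm (by fun_prop)
    · exact isClosed_le continuous_const (by fun_prop)
  have hcompact : IsCompact (indentedDisc c ∩ {z | δ ≤ ‖1 - z‖}) := by
    refine Metric.isCompact_of_isClosed_isBounded hclosed ?_
    refine (Metric.isBounded_closedBall (x := (0 : ℂ)) (r := 2)).subset fun z hz => ?_
    rw [mem_closedBall_zero_iff]
    exact (norm_le_of_mem_indentedDisc hc1 hz.1).1
  have hsub' : indentedDisc c ∩ {z | δ ≤ ‖1 - z‖} ⊆ deltaDomain 1 R φ := by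
    rintro z ⟨hz1, hz2⟩
    refine hsub ⟨hz1, fun h => ?_⟩
    rw [Set.mem_singleton_iff] at h
    simp only [Set.mem_ofPred_eq, h, sub_self, norm_zero] at hz2
    linarith
  obtain ⟨C₂, hC₂⟩ := hcompact.exists_bound_of_continuousOn (hcont.mono hsub')
  refine ⟨c, max (max C₁ (C₂ / δ)) 1, deltaDomain 1 R φ, hc0, hc1,
    lt_of_lt_of_le one_pos (le_max_right _ _), hsub, hslit, hdiff, ?_⟩
  intro z hz
  rcases lt_or_ge ‖1 - z‖ δ with hcase | hcase
  · have h1 := hC₁ (y := z) (by rwa [dist_eq_norm, norm_sub_rev, Complex.ofReal_one]) (hsub hz)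
    have h2 : Complex.log (1 / (1 - z / ((1 : ℝ) : ℂ))) = -Complex.log (1 - z) := by
      rw [Complex.ofReal_one, div_one, one_div,
        Complex.log_inv _ (Complex.slitPlane_arg_ne_pi (hslit z (hsub hz)))]
    rw [h2, Complex.ofReal_one, norm_sub_rev z 1] at h1
    rw [show G z + ϑ * Complex.log (1 - z) - K = G z - (ϑ * -Complex.log (1 - z) + K) by ring]
    refine h1.trans ?_
    gcongr
    exact (le_max_left _ _).trans (le_max_left _ _)
  · have h1 := hC₂ z ⟨hz.1, hcase⟩
    have h0 : 0 ≤ C₂ := (norm_nonneg _).trans h1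
    calc ‖G z + ϑ * Complex.log (1 - z) - K‖ ≤ C₂ := h1
      _ = C₂ / δ * δ := by field_simp
      _ ≤ C₂ / δ * ‖1 - z‖ := by gcongr
      _ ≤ _ := by
        gcongr
        exact (le_max_right _ _).trans (le_max_left _ _)

/-- The case `M = 1` of the transfer estimate. Taking `k ≥ 2 - b` also makes the far term `N^{-k}`
at most `N^{b - 1}`. -/
theorem eventually_norm_taylorCoeff_le {c : ℝ} (hc0 : 0 < c) (hc1 : c ≤ 1 / 4) (b : ℝ) :
    ∃ (C : ℝ) (N₀ : ℕ), 0 < C ∧ ∀ (U : Set ℂ) (f : ℂ → ℂ) (A : ℝ), 0 ≤ A →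
      DifferentiableOn ℂ f U → indentedDisc c \ {1} ⊆ U →
      (∀ z ∈ indentedDisc c \ {1}, ‖f z‖ ≤ A * ‖1 - z‖ ^ (-b)) →
      ∀ N : ℕ, N₀ ≤ N → ‖taylorCoeff f N‖ ≤ C * A * (N : ℝ) ^ (b - 1) := by
  obtain ⟨k, hk⟩ := exists_nat_ge (2 - b)
  obtain ⟨C, hC, h⟩ := norm_taylorCoeff_le_of_indentedDisc hc0 (by linarith) b k (by linarith)
  refine ⟨C * (1 + 4 ^ |b|), k + 1, by positivity, ?_⟩
  intro U f A hA hf hU hbd N hN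
  have hNpos : (1 : ℝ) ≤ N := by exact_mod_cast (by omega : 1 ≤ N)
  have h1 := h U f 1 A (A * 4 ^ |b|) le_rfl hA (by positivity) hf hU (fun z hz _ => hbd z hz)
    (fun z hz _ hz2 => by
      refine (hbd z hz).trans ?_
      gcongr
      have h3 := (norm_le_of_mem_indentedDisc hc1 hz.1).2
      have h4 := rpow_le_of_ratio_le (x := ‖1 - z‖) (y := 1) (q := 4) (e := -b) (by linarith)
        one_pos (by norm_num) (by linarith) (by linarith)
      rwa [abs_neg, Real.one_rpow, mul_one] at h4) N hN
  have h2 : (1 / (N : ℝ)) ^ k ≤ (N : ℝ) ^ (b - 1) := by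
    rw [one_div, inv_pow, ← Real.rpow_natCast, ← Real.rpow_neg (by linarith)]
    exact Real.rpow_le_rpow_of_exponent_le hNpos (by linarith)
  refine h1.trans ?_
  calc C * (A * (N : ℝ) ^ (b - 1) + A * 4 ^ |b| * (1 / (N : ℝ)) ^ k)
      ≤ C * (A * (N : ℝ) ^ (b - 1) + A * 4 ^ |b| * (N : ℝ) ^ (b - 1)) := by gcongr
    _ = _ := by ring

theorem norm_exp_sub_one_le_mul_exp (u : ℂ) : ‖Complex.exp u - 1‖ ≤ ‖u‖ * Real.exp ‖u‖ := by
  simpa using Complex.norm_exp_sub_sum_le_norm_mul_exp u 1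

theorem norm_exp_neg_mul_log {ϑ : ℝ} {z : ℂ} (hz : z ≠ 0) :
    ‖Complex.exp (-(ϑ * Complex.log z))‖ = ‖z‖ ^ (-ϑ) := by
  rw [Complex.norm_exp, Real.rpow_def_of_pos (norm_pos_iff.2 hz)]
  simp [Complex.log_re, mul_comm]

namespace LogSingular

variable {G : ℂ → ℂ} {ϑ K c C : ℝ} {U : Set ℂ}

theorem ball_subset (h : LogSingular G ϑ K c C U) : Metric.ball (0 : ℂ) 1 ⊆ U :=
  (ball_subset_indentedDisc h.c_pos.le).trans h.subset

theorem analyticAt_of_differentiableOn (h : LogSingular G ϑ K c C U) {f : ℂ → ℂ}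
    (hf : DifferentiableOn ℂ f U) : AnalyticAt ℂ f 0 :=
  (hf.mono h.ball_subset).analyticAt (Metric.ball_mem_nhds _ one_pos)

theorem differentiableOn_log (h : LogSingular G ϑ K c C U) :
    DifferentiableOn ℂ (fun z => Complex.log (1 - z)) U :=
  ((differentiableOn_const _).sub differentiableOn_id).clog h.slit

theorem norm_pos (h : LogSingular G ϑ K c C U) {z : ℂ} (hz : z ∈ U) : 0 < ‖1 - z‖ :=
  norm_pos_iff.2 (Complex.slitPlane_ne_zero (h.slit z hz))

theorem exp_eq (z : ℂ) : Complex.exp (G z) =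
    Complex.exp K * Complex.exp (-(ϑ * Complex.log (1 - z))) *
      Complex.exp (G z + ϑ * Complex.log (1 - z) - K) := by
  rw [← Complex.exp_add, ← Complex.exp_add]
  congr 1
  ring

theorem norm_remainder_le (h : LogSingular G ϑ K c C U) {z : ℂ} (hz : z ∈ indentedDisc c \ {1}) :
    ‖G z + ϑ * Complex.log (1 - z) - K‖ ≤ 3 * C := by
  have h1 := h.bound z hz
  have h2 := (norm_le_of_mem_indentedDisc h.c_le hz.1).2
  have := h.C_pos
  nlinarith

theorem norm_exp_le (h : LogSingular G ϑ K c C U) {z : ℂ} (hz : z ∈ indentedDisc c \ {1}) :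
    ‖Complex.exp (G z)‖ ≤ Real.exp (K + 3 * C) * ‖1 - z‖ ^ (-ϑ) := by
  have h1 := (Complex.norm_exp_le_exp_norm _).trans (Real.exp_le_exp.2 (h.norm_remainder_le hz))
  rw [exp_eq (ϑ := ϑ) (K := K), norm_mul, norm_mul,
    norm_exp_neg_mul_log (norm_pos_iff.1 (h.norm_pos (h.subset hz))), Complex.norm_exp,
    Complex.ofReal_re, Real.exp_add]
  calc _ ≤ Real.exp K * ‖1 - z‖ ^ (-ϑ) * Real.exp (3 * C) := by gcongr
    _ = _ := by ring

/-- The relative error `e^v - 1` with `v = O(1 - z)` gains one power of `|1 - z|` over the main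
term. -/
theorem norm_exp_sub_le (h : LogSingular G ϑ K c C U) {z : ℂ} (hz : z ∈ indentedDisc c \ {1}) :
    ‖Complex.exp (G z) - Complex.exp K * Complex.exp (-(ϑ * Complex.log (1 - z)))‖ ≤
      C * Real.exp (K + 3 * C) * ‖1 - z‖ ^ (-(ϑ - 1)) := by
  have hpos := h.norm_pos (h.subset hz)
  have h1 := norm_exp_sub_one_le_mul_exp (G z + ϑ * Complex.log (1 - z) - K)
  have h2 := h.bound z hz
  have h3 := Real.exp_le_exp.2 (h.norm_remainder_le hz)
  have hC := h.C_pos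
  rw [exp_eq (ϑ := ϑ) (K := K), ← mul_sub_one, norm_mul, norm_mul,
    norm_exp_neg_mul_log (norm_pos_iff.1 hpos), Complex.norm_exp, Complex.ofReal_re, Real.exp_add,
    show -(ϑ - 1) = -ϑ + 1 by ring, Real.rpow_add_one hpos.ne']
  calc _ ≤ Real.exp K * ‖1 - z‖ ^ (-ϑ) * (C * ‖1 - z‖ * Real.exp (3 * C)) := by
        refine mul_le_mul_of_nonneg_left (h1.trans ?_) (by positivity)
        gcongr
    _ = _ := by ring

end LogSingular

/-! ### Bounded weights and a lower bound for the normalization constant -/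

theorem taylorCoeff_of_isGeneratingFunction {θ : ℕ → ℝ} {G : ℂ → ℂ}
    (hG : IsGeneratingFunction θ G) (n : ℕ) : taylorCoeff G n = (θ n : ℂ) / (n : ℂ) := by
  refine taylorCoeff_of_hasSum (a := fun n => (θ n : ℂ) / (n : ℂ)) ?_ n
  filter_upwards [hG] with t ht
  -- The index `0` is covered because division by zero gives `0`, the missing constant term,
  -- whatever `θ 0` is.
  rw [← hasSum_nat_add_iff' 1]
  simpa using ht

theorem isGeneratingFunction_zero {θ : ℕ → ℝ} {G : ℂ → ℂ} (hG : IsGeneratingFunction θ G) :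
    G 0 = 0 := by
  have h := hG.self_of_nhds
  simp only [ne_eq, Nat.add_eq_zero_iff, one_ne_zero, and_false, not_false_eq_true, zero_pow,
    mul_zero] at h
  exact h.unique hasSum_zero

theorem taylorCoeff_log_one_sub (n : ℕ) :
    taylorCoeff (fun z => Complex.log (1 - z)) n = -(1 / (n : ℂ)) := by
  refine taylorCoeff_of_hasSum (a := fun n => -(1 / (n : ℂ))) ?_ n
  filter_upwards [Metric.ball_mem_nhds (0 : ℂ) one_pos] with t ht
  have := (Complex.hasSum_taylorSeries_neg_log (mem_ball_zero_iff.1 ht)).neg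
  rw [neg_neg] at this
  refine this.congr_fun fun n => ?_
  ring

/-- For `N ≥ 1`, `(θ_N - ϑ)/N` is the coefficient of `G + ϑ log (1 - z) - K = O(1 - z)`, hence
`O(N^{-2})` by transfer with `b = -1`. The finitely many small indices are absorbed into the
constant. -/
theorem exists_weight_bound {θ : ℕ → ℝ} {G : ℂ → ℂ} {ϑ K c C : ℝ} {U : Set ℂ}
    (h : LogSingular G ϑ K c C U) (hG : IsGeneratingFunction θ G) :
    ∃ T : ℝ, 0 < T ∧ ∀ m : ℕ, 1 ≤ m → |θ m| ≤ T := by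
  obtain ⟨C', N₀, hC', h1⟩ := eventually_norm_taylorCoeff_le h.c_pos h.c_le (-1)
  have hGa := h.analyticAt_of_differentiableOn h.diff
  have hL := h.analyticAt_of_differentiableOn h.differentiableOn_log
  have h2 : ∀ N : ℕ, max N₀ 1 ≤ N → |θ N| ≤ |ϑ| + C' * C := by
    intro N hN
    have hN1 : 1 ≤ N := (le_max_right _ _).trans hN
    have hNr : (1 : ℝ) ≤ N := by exact_mod_cast hN1
    have h3 := h1 U (fun z => G z + ϑ * Complex.log (1 - z) - K) C h.C_pos.le
      ((h.diff.add ((differentiableOn_const _).mul h.differentiableOn_log)).sub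
        (differentiableOn_const _)) h.subset
      (fun z hz => by simpa using h.bound z hz) N ((le_max_left _ _).trans hN)
    obtain ⟨n, rfl⟩ : ∃ n, N = n + 1 := ⟨N - 1, by omega⟩
    have hmul : AnalyticAt ℂ (fun z => (ϑ : ℂ) * Complex.log (1 - z)) 0 := analyticAt_const.mul hL
    have hadd : AnalyticAt ℂ (fun z => G z + (ϑ : ℂ) * Complex.log (1 - z)) 0 := hGa.add hmul
    rw [taylorCoeff_sub hadd analyticAt_const, taylorCoeff_add hGa hmul, taylorCoeff_const_mul,
      taylorCoeff_log_one_sub, taylorCoeff_const_succ,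
      taylorCoeff_of_isGeneratingFunction hG] at h3
    set N : ℕ := n + 1
    have hNpos : (0 : ℝ) < N := by linarith
    have h4 : (θ N : ℂ) / (N : ℂ) + ϑ * -(1 / (N : ℂ)) - 0 = (((θ N - ϑ) / N : ℝ) : ℂ) := by
      push_cast; ring
    rw [h4, Complex.norm_real, Real.norm_eq_abs, abs_div, abs_of_pos hNpos,
      div_le_iff₀ hNpos, mul_assoc] at h3
    have h5 : (N : ℝ) ^ ((-1 : ℝ) - 1) * N ≤ 1 := by
      rw [← Real.rpow_add_one hNpos.ne']
      exact Real.rpow_le_one_of_one_le_of_nonpos hNr (by norm_num)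
    have h6 : |θ N - ϑ| ≤ C' * C := by
      have : 0 < C' * C := mul_pos hC' h.C_pos
      nlinarith
    have := abs_sub_abs_le_abs_sub (θ N) ϑ
    linarith
  refine ⟨|ϑ| + C' * C + ∑ m ∈ Finset.range (max N₀ 1), |θ m|, ?_, ?_⟩
  · have := mul_pos hC' h.C_pos
    positivity
  · intro m _
    rcases lt_or_ge m (max N₀ 1) with hm | hm
    · have h3 := Finset.single_le_sum (f := fun m => |θ m|) (fun i _ => abs_nonneg _)
        (Finset.mem_range.2 hm)
      have := mul_pos hC' h.C_pos
      have := abs_nonneg ϑ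
      linarith
    · have := h2 m hm
      have : 0 ≤ ∑ m ∈ Finset.range (max N₀ 1), |θ m| := Finset.sum_nonneg fun i _ => abs_nonneg _
      linarith

/-- For constant weights, consecutive instances of the recurrence differ by one term, leaving a
two-term recurrence solved by the rising factorial. -/
theorem cycleSum_const (ϑ : ℝ) (n : ℕ) :
    cycleSum (fun _ => (ϑ : ℂ)) n =
      (((∏ j ∈ Finset.range n, (ϑ + j)) / (n.factorial : ℝ) : ℝ) : ℂ) := by
  have hrec : ∀ n : ℕ, ((n + 1 : ℕ) : ℂ) * cycleSum (fun _ => (ϑ : ℂ)) (n + 1) =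
      ϑ * ∑ j ∈ Finset.range (n + 1), cycleSum (fun _ => (ϑ : ℂ)) j := by
    intro n
    rw [succ_mul_cycleSum_succ, ← Finset.mul_sum, ← Finset.sum_range_reflect]
    congr 1
    refine Finset.sum_congr rfl fun j hj => ?_
    have := Finset.mem_range.1 hj
    rw [show n - (n + 1 - 1 - j) = j by omega]
  have hstep : ∀ n : ℕ, ((n + 1 : ℕ) : ℂ) * cycleSum (fun _ => (ϑ : ℂ)) (n + 1) =
      (ϑ + n) * cycleSum (fun _ => (ϑ : ℂ)) n := by
    intro n
    rw [hrec, Finset.sum_range_succ, mul_add]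
    cases n with
    | zero => simp
    | succ n => rw [← hrec]; ring
  induction n with
  | zero => simp [cycleSum_zero]
  | succ n ih =>
    have hn1 : ((n + 1 : ℕ) : ℂ) ≠ 0 := Nat.cast_ne_zero.2 n.succ_ne_zero
    have hnf : (n.factorial : ℂ) ≠ 0 := Nat.cast_ne_zero.2 n.factorial_ne_zero
    apply mul_left_cancel₀ hn1
    rw [hstep, ih, Finset.prod_range_succ, Nat.factorial_succ]
    push_cast at hn1 ⊢
    field_simp

theorem taylorCoeff_exp_neg_mul_log (ϑ : ℝ) (n : ℕ) :
    taylorCoeff (fun z => Complex.exp (-(ϑ * Complex.log (1 - z)))) n =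
      cycleSum (fun _ => (ϑ : ℂ)) n := by
  have hL : AnalyticAt ℂ (fun z => Complex.log (1 - z)) 0 :=
    (analyticAt_const.sub analyticAt_id).clog (by simp)
  have hh : AnalyticAt ℂ (fun z => -((ϑ : ℂ) * Complex.log (1 - z))) 0 :=
    (analyticAt_const.mul hL).neg
  refine taylorCoeff_exp hh (by simp) (fun k => ?_) n
  have h1 : (fun z => -((ϑ : ℂ) * Complex.log (1 - z))) =
      fun z => (-(ϑ : ℂ)) * Complex.log (1 - z) := by ext; ring
  have hk : ((k + 1 : ℕ) : ℂ) ≠ 0 := Nat.cast_ne_zero.2 k.succ_ne_zero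
  rw [h1, taylorCoeff_const_mul, taylorCoeff_log_one_sub]
  field_simp

/-- The sequence is the reciprocal of Euler's `Real.GammaSeq` times `n / (n + ϑ)`. -/
theorem tendsto_cycleSum_const {ϑ : ℝ} (hϑ : 0 < ϑ) :
    Tendsto (fun n : ℕ => (∏ j ∈ Finset.range n, (ϑ + j)) / (n.factorial : ℝ) *
      (n : ℝ) ^ (1 - ϑ)) atTop (𝓝 (Real.Gamma ϑ)⁻¹) := by
  have h1 := (Real.GammaSeq_tendsto_Gamma ϑ).inv₀ (Real.Gamma_pos_of_pos hϑ).ne'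
  have h2 : Tendsto (fun n : ℕ => (n : ℝ) / (n + ϑ)) atTop (𝓝 1) :=
    tendsto_natCast_div_add_atTop ϑ
  have h3 := h1.mul h2
  rw [mul_one] at h3
  refine h3.congr' ?_
  filter_upwards [eventually_ge_atTop 1] with n hn
  have hn0 : (0 : ℝ) < n := by exact_mod_cast hn
  have hnf : (n.factorial : ℝ) ≠ 0 := Nat.cast_ne_zero.2 n.factorial_ne_zero
  have hpow : (n : ℝ) ^ ϑ ≠ 0 := (Real.rpow_pos_of_pos hn0 ϑ).ne'
  have hsum : (n : ℝ) + ϑ ≠ 0 := by positivity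
  rw [Real.GammaSeq, Finset.prod_range_succ, Real.rpow_sub hn0, Real.rpow_one, add_comm ϑ (n : ℝ)]
  field_simp

/-- Compare `exp G` with `e^K (1 - z)^{-ϑ}`: the coefficients differ by `O(n^{ϑ - 2})`, while those
of the latter are of order `n^{ϑ - 1}`. -/
theorem exists_le_norm_cycleSum {θ : ℕ → ℝ} {G : ℂ → ℂ} {ϑ K c C : ℝ} {U : Set ℂ}
    (hϑ : 0 < ϑ) (h : LogSingular G ϑ K c C U) (hG : IsGeneratingFunction θ G) :
    ∃ (κ : ℝ) (N₀ : ℕ), 0 < κ ∧ ∀ n : ℕ, N₀ ≤ n →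
      κ * (n : ℝ) ^ (ϑ - 1) ≤ ‖cycleSum (fun m => (θ m : ℂ)) n‖ := by
  obtain ⟨C', N₁, hC', h1⟩ := eventually_norm_taylorCoeff_le h.c_pos h.c_le (ϑ - 1)
  have hGa := h.analyticAt_of_differentiableOn h.diff
  have hSd : DifferentiableOn ℂ (fun z => Complex.exp (-(ϑ * Complex.log (1 - z)))) U :=
    ((differentiableOn_const _).mul h.differentiableOn_log).neg.cexp
  have hSa := h.analyticAt_of_differentiableOn hSd
  set B : ℝ := C' * (C * Real.exp (K + 3 * C)) with hB
  have hB0 : 0 ≤ B := by have := h.C_pos; positivity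
  have h2 : ∀ n : ℕ, N₁ ≤ n → ‖cycleSum (fun m => (θ m : ℂ)) n -
      Complex.exp K * cycleSum (fun _ => (ϑ : ℂ)) n‖ ≤ B * (n : ℝ) ^ (ϑ - 1 - 1) := by
    intro n hn
    have h3 := h1 U (fun z => Complex.exp (G z) -
      Complex.exp K * Complex.exp (-(ϑ * Complex.log (1 - z)))) (C * Real.exp (K + 3 * C))
      (by have := h.C_pos; positivity) (h.diff.cexp.sub ((differentiableOn_const _).mul hSd))
      h.subset (fun z hz => h.norm_exp_sub_le hz) n hn
    have hexp : AnalyticAt ℂ (fun z => Complex.exp (G z)) 0 := hGa.cexp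
    have hmul : AnalyticAt ℂ
      (fun z => Complex.exp K * Complex.exp (-(ϑ * Complex.log (1 - z)))) 0 :=
      analyticAt_const.mul hSa
    rwa [taylorCoeff_sub hexp hmul, taylorCoeff_const_mul,
      taylorCoeff_exp_neg_mul_log, taylorCoeff_exp (a := fun m => (θ m : ℂ)) hGa
        (isGeneratingFunction_zero hG) (fun k => by
          have hk : ((k + 1 : ℕ) : ℂ) ≠ 0 := Nat.cast_ne_zero.2 k.succ_ne_zero
          rw [taylorCoeff_of_isGeneratingFunction hG]
          field_simp)] at h3
  have hΓ : 0 < (Real.Gamma ϑ)⁻¹ := inv_pos.2 (Real.Gamma_pos_of_pos hϑ)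
  set γ := (Real.Gamma ϑ)⁻¹
  -- Eventually the main term is at least `2κ n^{ϑ - 1}` and, once `n ≥ B / κ`, the error at most `κ
  -- n^{ϑ - 1}`.
  set κ : ℝ := Real.exp K * γ / 4 with hκ
  have hκ0 : 0 < κ := by positivity
  have h4 : ∀ᶠ n : ℕ in atTop, γ / 2 ≤ (∏ j ∈ Finset.range n, (ϑ + j)) / (n.factorial : ℝ) *
      (n : ℝ) ^ (1 - ϑ) :=
    (tendsto_cycleSum_const hϑ).eventually (eventually_ge_nhds (by linarith))
  have h5 : ∀ᶠ n : ℕ in atTop, B / κ ≤ n := tendsto_natCast_atTop_atTop.eventually_ge_atTop _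
  obtain ⟨N₀, hN₀⟩ := eventually_atTop.1
    ((h4.and h5).and ((eventually_ge_atTop N₁).and (eventually_ge_atTop 1)))
  refine ⟨κ, N₀, hκ0, fun n hn => ?_⟩
  obtain ⟨⟨h6, h7⟩, h8, h9⟩ := hN₀ n hn
  have hn0 : (0 : ℝ) < n := by exact_mod_cast h9
  have h10 := h2 n h8
  rw [cycleSum_const] at h10
  set s : ℝ := (∏ j ∈ Finset.range n, (ϑ + j)) / (n.factorial : ℝ)
  have hs : γ / 2 * (n : ℝ) ^ (ϑ - 1) ≤ s := by
    have := mul_le_mul_of_nonneg_right h6 (Real.rpow_nonneg hn0.le (ϑ - 1))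
    rwa [mul_assoc, ← Real.rpow_add hn0, show 1 - ϑ + (ϑ - 1) = 0 by ring, Real.rpow_zero,
      mul_one] at this
  have hpw : 0 < (n : ℝ) ^ (ϑ - 1) := Real.rpow_pos_of_pos hn0 _
  have h11 : B * (n : ℝ) ^ (ϑ - 1 - 1) ≤ κ * (n : ℝ) ^ (ϑ - 1) := by
    rw [Real.rpow_sub_one hn0.ne', mul_div_assoc', div_le_iff₀ hn0]
    rw [div_le_iff₀ hκ0] at h7
    nlinarith
  have h12 : ‖Complex.exp K * (s : ℂ)‖ = Real.exp K * s := by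
    have : 0 ≤ s := le_trans (by positivity) hs
    rw [norm_mul, Complex.norm_exp, Complex.ofReal_re, Complex.norm_real, Real.norm_of_nonneg this]
  have h13 := norm_sub_norm_le (Complex.exp K * (s : ℂ))
    (Complex.exp K * (s : ℂ) - cycleSum (fun m => (θ m : ℂ)) n)
  rw [sub_sub_cancel, norm_sub_rev _ (cycleSum _ n), h12] at h13
  have h14 : 2 * κ * (n : ℝ) ^ (ϑ - 1) ≤ Real.exp K * s := by
    calc 2 * κ * (n : ℝ) ^ (ϑ - 1) = Real.exp K * (γ / 2 * (n : ℝ) ^ (ϑ - 1)) := by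
          rw [hκ]; ring
      _ ≤ _ := by gcongr
  linarith

/-! ### The truncated series and the twisted cycle sums -/

/-- `L_D(z)` as a polynomial function of a complex variable. -/
def complexSeries (θ : ℕ → ℝ) (D : Finset ℕ) (z : ℂ) : ℂ :=
  ∑ m ∈ D, (θ m : ℂ) / (m : ℂ) * z ^ m

theorem complexSeries_one (θ : ℕ → ℝ) (D : Finset ℕ) :
    complexSeries θ D 1 = (partialSeries θ D 1 : ℂ) := by
  simp [complexSeries, partialSeries]

theorem taylorCoeff_complexSeries (θ : ℕ → ℝ) (D : Finset ℕ) (n : ℕ) :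
    taylorCoeff (complexSeries θ D) n = if n ∈ D then (θ n : ℂ) / (n : ℂ) else 0 := by
  refine taylorCoeff_of_hasSum (a := fun n => if n ∈ D then (θ n : ℂ) / (n : ℂ) else 0) ?_ n
  refine Eventually.of_forall fun t => ?_
  have h : complexSeries θ D t =
      ∑ m ∈ D, (if m ∈ D then (θ m : ℂ) / (m : ℂ) else 0) * t ^ m :=
    Finset.sum_congr rfl fun m hm => by rw [if_pos hm]
  rw [h]
  exact hasSum_sum_of_ne_finset_zero fun m hm => by rw [if_neg hm, zero_mul]

theorem differentiable_complexSeries (θ : ℕ → ℝ) (D : Finset ℕ) :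
    Differentiable ℂ (complexSeries θ D) := by
  unfold complexSeries
  fun_prop

theorem complexSeries_zero (θ : ℕ → ℝ) {D : Finset ℕ} (hD : 0 ∉ D) : complexSeries θ D 0 = 0 := by
  refine Finset.sum_eq_zero fun m hm => ?_
  rw [zero_pow (by rintro rfl; exact hD hm), mul_zero]

/-- As `(1 + 1/M)^m ≤ e^{m/M} ≤ e`, the polynomial of degree at most `M` is controlled only this far
outside the unit disc, hence the restriction on `‖z‖` in the far bound of the transfer estimate. -/
theorem norm_pow_le_three {M : ℝ} (hM : 1 ≤ M) {z : ℂ} (hz : ‖z‖ ≤ 1 + 1 / M) {m : ℕ}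
    (hm : (m : ℝ) ≤ M) : ‖z‖ ^ m ≤ 3 := by
  have hM0 : 0 < M := by linarith
  calc ‖z‖ ^ m ≤ (Real.exp (1 / M)) ^ m := by
        gcongr
        linarith [Real.add_one_le_exp (1 / M)]
    _ = Real.exp (m / M) := by rw [← Real.exp_nat_mul]; congr 1; ring
    _ ≤ Real.exp 1 := by
        apply Real.exp_le_exp.2
        rwa [div_le_one hM0]
    _ ≤ 3 := by linarith [Real.exp_one_lt_d9]

theorem mem_Icc_floor {M : ℝ} (hM : 1 ≤ M) {m : ℕ} (hm : m ∈ Finset.Icc 1 ⌊M⌋₊) :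
    1 ≤ m ∧ (m : ℝ) ≤ M := by
  rw [Finset.mem_Icc] at hm
  exact ⟨hm.1, (Nat.le_floor_iff (by linarith)).1 hm.2⟩

theorem complexSeries_sub (θ : ℕ → ℝ) (D : Finset ℕ) (z : ℂ) :
    complexSeries θ D z - complexSeries θ D 1 =
      ∑ m ∈ D, (θ m : ℂ) / (m : ℂ) * (z ^ m - 1) := by
  rw [complexSeries, complexSeries, ← Finset.sum_sub_distrib]
  exact Finset.sum_congr rfl fun m _ => by rw [one_pow, mul_sub]

/-- The bound used near `1`: `|z^m - 1| ≤ 3m|1 - z|`, the `m` cancels the denominator, and there are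
at most `M` terms. -/
theorem norm_complexSeries_sub_le_mul {θ : ℕ → ℝ} {T M : ℝ} (hT : ∀ m : ℕ, 1 ≤ m → |θ m| ≤ T)
    (hM : 1 ≤ M) {z : ℂ} (hz : ‖z‖ ≤ 1 + 1 / M) :
    ‖complexSeries θ (Finset.Icc 1 ⌊M⌋₊) z - complexSeries θ (Finset.Icc 1 ⌊M⌋₊) 1‖ ≤
      3 * T * M * ‖1 - z‖ := by
  have hT0 : 0 ≤ T := (abs_nonneg _).trans (hT 1 le_rfl)
  rw [complexSeries_sub]
  have hterm : ∀ m ∈ Finset.Icc 1 ⌊M⌋₊,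
      ‖(θ m : ℂ) / (m : ℂ) * (z ^ m - 1)‖ ≤ 3 * T * ‖1 - z‖ := by
    intro m hm
    obtain ⟨hm1, hmM⟩ := mem_Icc_floor hM hm
    have hm0 : (0 : ℝ) < m := by exact_mod_cast hm1
    have h1 : ‖z ^ m - 1‖ ≤ (m * 3) * ‖1 - z‖ := by
      rw [← geom_sum_mul, norm_mul, norm_sub_rev z 1]
      gcongr
      refine (norm_sum_le _ _).trans ?_
      refine (Finset.sum_le_card_nsmul _ _ 3 fun i hi => ?_).trans (by simp)
      rw [norm_pow]
      refine norm_pow_le_three hM hz (le_trans ?_ hmM)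
      exact_mod_cast (Finset.mem_range.1 hi).le
    rw [norm_mul, norm_div, Complex.norm_real, Complex.norm_natCast, Real.norm_eq_abs]
    calc |θ m| / m * ‖z ^ m - 1‖ ≤ T / m * ((m * 3) * ‖1 - z‖) := by
          gcongr
          exact hT m hm1
      _ = 3 * T * ‖1 - z‖ := by field_simp
  calc _ ≤ ∑ m ∈ Finset.Icc 1 ⌊M⌋₊, 3 * T * ‖1 - z‖ := norm_sum_le_of_le _ hterm
    _ = ⌊M⌋₊ * (3 * T * ‖1 - z‖) := by simp
    _ ≤ M * (3 * T * ‖1 - z‖) := by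
        gcongr
        exact Nat.floor_le (by linarith)
    _ = _ := by ring

/-- The bound used away from `1`: a harmonic sum, whose logarithmic growth costs only a power of `M`
after exponentiation. -/
theorem norm_complexSeries_sub_le_log {θ : ℕ → ℝ} {T M : ℝ} (hT : ∀ m : ℕ, 1 ≤ m → |θ m| ≤ T)
    (hM : 1 ≤ M) {z : ℂ} (hz : ‖z‖ ≤ 1 + 1 / M) :
    ‖complexSeries θ (Finset.Icc 1 ⌊M⌋₊) z - complexSeries θ (Finset.Icc 1 ⌊M⌋₊) 1‖ ≤
      4 * T * (1 + Real.log M) := by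
  have hT0 : 0 ≤ T := (abs_nonneg _).trans (hT 1 le_rfl)
  rw [complexSeries_sub]
  have hterm : ∀ m ∈ Finset.Icc 1 ⌊M⌋₊,
      ‖(θ m : ℂ) / (m : ℂ) * (z ^ m - 1)‖ ≤ 4 * T * (m : ℝ)⁻¹ := by
    intro m hm
    obtain ⟨hm1, hmM⟩ := mem_Icc_floor hM hm
    have hm0 : (0 : ℝ) < m := by exact_mod_cast hm1
    have h1 : ‖z ^ m - 1‖ ≤ 4 := by
      refine (norm_sub_le _ _).trans ?_
      rw [norm_pow, norm_one]
      linarith [norm_pow_le_three hM hz hmM]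
    rw [norm_mul, norm_div, Complex.norm_real, Complex.norm_natCast, Real.norm_eq_abs]
    calc |θ m| / m * ‖z ^ m - 1‖ ≤ T / m * 4 := by
          gcongr
          exact hT m hm1
      _ = _ := by ring
  refine (norm_sum_le_of_le _ hterm).trans ?_
  rw [← Finset.mul_sum]
  gcongr
  have h := harmonic_floor_le_one_add_log M hM
  rw [harmonic_eq_sum_Icc] at h
  push_cast at h
  exact h

/-- The cycle weights `θ`, multiplied by `w` on `D`. -/
def twistedWeight (θ : ℕ → ℝ) (D : Finset ℕ) (w : ℂ) (m : ℕ) : ℂ :=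
  (θ m : ℂ) * if m ∈ D then w else 1

/-- Isolates the error: `exp (G + (w - 1) L_D)` is split as `exp ((w - 1) L_D(1))` times `exp G +
exp G (e^u - 1)`, with `u(1) = 0`. -/
theorem taylorCoeff_exp_mul_exp_sub_one {θ : ℕ → ℝ} {G : ℂ → ℂ} (hGa : AnalyticAt ℂ G 0)
    (hG : IsGeneratingFunction θ G) {D : Finset ℕ} (hD : 0 ∉ D) (w : ℂ) (n : ℕ) :
    cycleSum (twistedWeight θ D w) n =
      Complex.exp ((w - 1) * complexSeries θ D 1) * (cycleSum (fun m => (θ m : ℂ)) n +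
        taylorCoeff (fun z => Complex.exp (G z) *
          (Complex.exp ((w - 1) * (complexSeries θ D z - complexSeries θ D 1)) - 1)) n) := by
  have hL : AnalyticAt ℂ (complexSeries θ D) 0 := (differentiable_complexSeries θ D).analyticAt 0
  have hwL : AnalyticAt ℂ (fun z => (w - 1) * complexSeries θ D z) 0 := analyticAt_const.mul hL
  have hsum : AnalyticAt ℂ (fun z => G z + (w - 1) * complexSeries θ D z) 0 := hGa.add hwL
  have hG0 := isGeneratingFunction_zero hG
  have h1 : taylorCoeff (fun z => Complex.exp (G z)) n = cycleSum (fun m => (θ m : ℂ)) n := by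
    refine taylorCoeff_exp hGa hG0 (fun k => ?_) n
    have hk : ((k + 1 : ℕ) : ℂ) ≠ 0 := Nat.cast_ne_zero.2 k.succ_ne_zero
    rw [taylorCoeff_of_isGeneratingFunction hG]
    field_simp
  have h2 : taylorCoeff (fun z => Complex.exp (G z + (w - 1) * complexSeries θ D z)) n =
      cycleSum (twistedWeight θ D w) n := by
    refine taylorCoeff_exp hsum (by simp [hG0, complexSeries_zero θ hD]) (fun k => ?_) n
    have hk : ((k + 1 : ℕ) : ℂ) ≠ 0 := Nat.cast_ne_zero.2 k.succ_ne_zero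
    rw [taylorCoeff_add hGa hwL, taylorCoeff_const_mul, taylorCoeff_complexSeries,
      taylorCoeff_of_isGeneratingFunction hG, twistedWeight]
    split_ifs
    · field_simp
      ring
    · field_simp
      ring
  have h3 : (fun z => Complex.exp (G z) *
      (Complex.exp ((w - 1) * (complexSeries θ D z - complexSeries θ D 1)) - 1)) =
      fun z => Complex.exp (-((w - 1) * complexSeries θ D 1)) *
        Complex.exp (G z + (w - 1) * complexSeries θ D z) - Complex.exp (G z) := by
    ext z
    rw [mul_sub_one, ← Complex.exp_add, ← Complex.exp_add]
    congr 2
    ring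
  have hexp : AnalyticAt ℂ (fun z => Complex.exp (G z)) 0 := hGa.cexp
  have hexp2 : AnalyticAt ℂ (fun z => Complex.exp (-((w - 1) * complexSeries θ D 1)) *
      Complex.exp (G z + (w - 1) * complexSeries θ D z)) 0 := analyticAt_const.mul hsum.cexp
  rw [h3, taylorCoeff_sub hexp2 hexp, taylorCoeff_const_mul, h1, h2, add_sub_cancel, ← mul_assoc,
    ← Complex.exp_add, add_neg_cancel, Complex.exp_zero, one_mul]

theorem exists_norm_taylorCoeff_twist_le {θ : ℕ → ℝ} {G : ℂ → ℂ} {ϑ K c C T x : ℝ} {U : Set ℂ}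
    (hϑ : 0 < ϑ) (h : LogSingular G ϑ K c C U) (hT0 : 0 < T)
    (hT : ∀ m : ℕ, 1 ≤ m → |θ m| ≤ T) (hx0 : 0 ≤ x) (hx1 : x < 1) :
    ∃ (C' : ℝ) (N₀ : ℕ), 0 < C' ∧ ∀ n : ℕ, N₀ ≤ n → ∀ w : ℂ, ‖w - 1‖ ≤ 2 →
      ‖taylorCoeff (fun z => Complex.exp (G z) * (Complex.exp ((w - 1) *
        (complexSeries θ (smallLengths n x) z - complexSeries θ (smallLengths n x) 1)) - 1)) n‖ ≤
      C' * ((n : ℝ) ^ (x - 1) * (n : ℝ) ^ (ϑ - 1)) := by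
  -- Far from `1`, `M^ϑ` comes from `|1 - z|^{-ϑ}` with `|1 - z| ≥ 1/(4M)`, and `M^{16T}` from `|e^u
  -- - 1| ≤ e^{2|u|}` with `|u| ≤ 8T(1 + log M)`.
  set E : ℝ := ϑ + 16 * T with hE
  set a₀ : ℝ := Real.exp (K + 3 * C) * (6 * T * Real.exp (6 * T)) with ha₀
  set b₀ : ℝ := Real.exp (K + 3 * C) * (4 ^ ϑ * Real.exp (16 * T)) with hb₀
  -- The first bound is `(ϑ - 1) + k ≥ 2`, required for transfer; the second makes `M^E (M/n)^k` at
  -- most `n^{x - 1} n^{ϑ - 1}`.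
  obtain ⟨k, hk⟩ := exists_nat_ge (max (3 - ϑ) ((x * E + 2 - ϑ - x) / (1 - x)))
  have hk1 : 3 - ϑ ≤ k := (le_max_left _ _).trans hk
  have hk2 : (x * E + 2 - ϑ - x) ≤ k * (1 - x) := by
    rw [← div_le_iff₀ (by linarith)]
    exact (le_max_right _ _).trans hk
  obtain ⟨C₁, hC₁, htr⟩ := norm_taylorCoeff_le_of_indentedDisc h.c_pos (by linarith [h.c_le])
    (ϑ - 1) k (by linarith)
  refine ⟨C₁ * (a₀ + b₀), k + 1, by positivity, fun n hn w hw => ?_⟩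
  have hn0 : (1 : ℝ) ≤ n := by exact_mod_cast (by omega : 1 ≤ n)
  have hnpos : (0 : ℝ) < n := by linarith
  set M : ℝ := (n : ℝ) ^ x with hMdef
  have hM : 1 ≤ M := Real.one_le_rpow hn0 hx0
  have hM0 : 0 < M := by linarith
  set D := smallLengths n x with hD
  have hDM : D = Finset.Icc 1 ⌊M⌋₊ := rfl
  have hmain := htr U (fun z => Complex.exp (G z) * (Complex.exp ((w - 1) *
      (complexSeries θ D z - complexSeries θ D 1)) - 1)) M (a₀ * M) (b₀ * M ^ E) hM
    (by positivity) (by positivity)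
    (h.diff.cexp.mul ((((differentiable_complexSeries θ D).differentiableOn.sub_const _).const_mul
      _).cexp.sub_const _)) h.subset ?_ ?_ n hn
  · refine hmain.trans ?_
    have e1 : M * (n : ℝ) ^ (ϑ - 1 - 1) = (n : ℝ) ^ (x - 1) * (n : ℝ) ^ (ϑ - 1) := by
      rw [hMdef, ← Real.rpow_add hnpos, ← Real.rpow_add hnpos]
      congr 1; ring
    have e2 : M ^ E * (M / n) ^ k ≤ (n : ℝ) ^ (x - 1) * (n : ℝ) ^ (ϑ - 1) := by
      have : M / n = (n : ℝ) ^ (x - 1) := by rw [hMdef, Real.rpow_sub_one hnpos.ne']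
      rw [this, hMdef, ← Real.rpow_natCast, ← Real.rpow_mul hnpos.le, ← Real.rpow_mul hnpos.le,
        ← Real.rpow_add hnpos, ← Real.rpow_add hnpos]
      refine Real.rpow_le_rpow_of_exponent_le hn0 ?_
      linarith
    calc C₁ * (a₀ * M * (n : ℝ) ^ (ϑ - 1 - 1) + b₀ * M ^ E * (M / n) ^ k)
        = C₁ * (a₀ * (M * (n : ℝ) ^ (ϑ - 1 - 1)) + b₀ * (M ^ E * (M / n) ^ k)) := by ring
      _ ≤ C₁ * (a₀ * ((n : ℝ) ^ (x - 1) * (n : ℝ) ^ (ϑ - 1)) +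
          b₀ * ((n : ℝ) ^ (x - 1) * (n : ℝ) ^ (ϑ - 1))) := by
          rw [e1]
          gcongr
      _ = _ := by ring
  · intro z hz hz1
    have hpos := h.norm_pos (h.subset hz)
    have hzM : ‖z‖ ≤ 1 + 1 / M := by
      have h1 : ‖z‖ ≤ 1 + c * ‖1 - z‖ := hz.1
      have := h.c_pos
      have := h.c_le
      nlinarith
    have h1 := norm_complexSeries_sub_le_mul hT hM hzM
    rw [← hDM] at h1
    have h2 : ‖(w - 1) * (complexSeries θ D z - complexSeries θ D 1)‖ ≤
        6 * T * M * ‖1 - z‖ := by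
      rw [norm_mul]
      calc _ ≤ 2 * (3 * T * M * ‖1 - z‖) := by gcongr
        _ = _ := by ring
    have h3 : 6 * T * M * ‖1 - z‖ ≤ 6 * T := by
      rw [le_div_iff₀ hM0] at hz1
      calc 6 * T * M * ‖1 - z‖ = 6 * T * (‖1 - z‖ * M) := by ring
        _ ≤ 6 * T * 1 := by gcongr
        _ = _ := by ring
    have h4 := norm_exp_sub_one_le_mul_exp ((w - 1) * (complexSeries θ D z - complexSeries θ D 1))
    have h5 := h.norm_exp_le hz
    rw [norm_mul, show -(ϑ - 1) = -ϑ + 1 by ring, Real.rpow_add_one hpos.ne']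
    calc _ ≤ Real.exp (K + 3 * C) * ‖1 - z‖ ^ (-ϑ) *
          (6 * T * M * ‖1 - z‖ * Real.exp (6 * T)) := by
          refine mul_le_mul h5 (h4.trans ?_) (norm_nonneg _) (by positivity)
          gcongr
          exact h2.trans h3
      _ = _ := by rw [ha₀]; ring
  · intro z hz hzM hz1
    have hpos := h.norm_pos (h.subset hz)
    have h1 := norm_complexSeries_sub_le_log hT hM hzM
    rw [← hDM] at h1
    have hlog : 0 ≤ Real.log M := Real.log_nonneg hM
    set u := (w - 1) * (complexSeries θ D z - complexSeries θ D 1) with hu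
    have h2 : ‖u‖ ≤ 8 * T * (1 + Real.log M) := by
      rw [hu, norm_mul]
      calc _ ≤ 2 * (4 * T * (1 + Real.log M)) := by gcongr
        _ = _ := by ring
    have h3 : ‖Complex.exp u - 1‖ ≤ Real.exp (16 * T) * M ^ (16 * T) := by
      calc _ ≤ ‖u‖ * Real.exp ‖u‖ := norm_exp_sub_one_le_mul_exp u
        _ ≤ Real.exp ‖u‖ * Real.exp ‖u‖ := by
            gcongr
            linarith [Real.add_one_le_exp ‖u‖]
        _ = Real.exp (‖u‖ + ‖u‖) := (Real.exp_add _ _).symm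
        _ ≤ Real.exp (16 * T + Real.log M * (16 * T)) := by
            apply Real.exp_le_exp.2
            linarith
        _ = _ := by rw [Real.exp_add, Real.rpow_def_of_pos hM0]
    have h4 : ‖1 - z‖ ^ (-ϑ) ≤ 4 ^ ϑ * M ^ ϑ := by
      refine (Real.rpow_le_rpow_of_nonpos (by positivity) hz1 (by linarith)).trans (le_of_eq ?_)
      rw [one_div, Real.inv_rpow (by positivity), Real.rpow_neg (by positivity), inv_inv,
        Real.mul_rpow (by norm_num) hM0.le]
    have h5 := h.norm_exp_le hz
    rw [norm_mul]
    calc _ ≤ Real.exp (K + 3 * C) * (4 ^ ϑ * M ^ ϑ) * (Real.exp (16 * T) * M ^ (16 * T)) := by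
          refine mul_le_mul (h5.trans ?_) h3 (norm_nonneg _) (by positivity)
          gcongr
      _ = _ := by rw [hb₀, hE, Real.rpow_add hM0]; ring

/-- The twisted cycle sums are asymptotic to a multiple of the plain ones. -/
theorem exists_cycleSum_twistedWeight_eq {θ : ℕ → ℝ} {ϑ K x : ℝ} (hϑ : 0 < ϑ)
    (hg : SeriesMemClass θ 1 ϑ K) (hx0 : 0 ≤ x) (hx1 : x < 1) :
    ∃ (C : ℝ) (N : ℕ), ∀ n : ℕ, N ≤ n → cycleSum (fun m => (θ m : ℂ)) n ≠ 0 ∧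
      ∀ w : ℂ, ‖w - 1‖ ≤ 2 → ∃ ε : ℂ, ‖ε‖ ≤ C * (n : ℝ) ^ (x - 1) ∧
        cycleSum (twistedWeight θ (smallLengths n x) w) n =
          Complex.exp ((w - 1) * (partialSeries θ (smallLengths n x) 1 : ℂ)) * (1 + ε) *
            cycleSum (fun m => (θ m : ℂ)) n := by
  obtain ⟨G, hGmem, hG⟩ := hg
  obtain ⟨c, C, U, h⟩ := exists_logSingular hGmem
  obtain ⟨T, hT0, hT⟩ := exists_weight_bound h hG
  obtain ⟨C', N₁, hC', h1⟩ := exists_norm_taylorCoeff_twist_le hϑ h hT0 hT hx0 hx1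
  obtain ⟨κ, N₂, hκ, h2⟩ := exists_le_norm_cycleSum hϑ h hG
  refine ⟨C' / κ, max (max N₁ N₂) 1, fun n hn => ?_⟩
  have hn0 : (0 : ℝ) < n := by exact_mod_cast (le_max_right _ _).trans hn
  have h3 := h2 n ((le_max_right _ _).trans ((le_max_left _ _).trans hn))
  have hpw : 0 < (n : ℝ) ^ (ϑ - 1) := Real.rpow_pos_of_pos hn0 _
  have hpos : 0 < ‖cycleSum (fun m => (θ m : ℂ)) n‖ := lt_of_lt_of_le (by positivity) h3
  have hne : cycleSum (fun m => (θ m : ℂ)) n ≠ 0 := norm_pos_iff.1 hpos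
  refine ⟨hne, fun w hw => ?_⟩
  have h4 := h1 n ((le_max_left _ _).trans ((le_max_left _ _).trans hn)) w hw
  have h5 := taylorCoeff_exp_mul_exp_sub_one (h.analyticAt_of_differentiableOn h.diff) hG
    (D := smallLengths n x) (by simp [smallLengths]) w n
  rw [complexSeries_one] at h4 h5
  generalize taylorCoeff _ n = e at h4 h5
  refine ⟨e / cycleSum (fun m => (θ m : ℂ)) n, ?_, ?_⟩
  rotate_left
  · rw [h5, mul_assoc]
    congr 1
    rw [add_mul, one_mul, div_mul_cancel₀ _ hne]
  · rw [norm_div, div_le_iff₀ hpos]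
    refine h4.trans ?_
    have hpx : 0 < (n : ℝ) ^ (x - 1) := Real.rpow_pos_of_pos hn0 _
    calc C' * ((n : ℝ) ^ (x - 1) * (n : ℝ) ^ (ϑ - 1))
        = C' / κ * (n : ℝ) ^ (x - 1) * (κ * (n : ℝ) ^ (ϑ - 1)) := by field_simp
      _ ≤ _ := by gcongr

/-! ### Reduction to radius one -/

theorem seriesMemClass_rescale {θ : ℕ → ℝ} {r ϑ K : ℝ} (hr : 0 < r)
    (hg : SeriesMemClass θ r ϑ K) : SeriesMemClass (fun m => θ m * r ^ m) 1 ϑ K := by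
  obtain ⟨g, ⟨R, φ, hR, hφ0, hφ, hdiff, hO⟩, hgen⟩ := hg
  have hrc : (r : ℂ) ≠ 0 := Complex.ofReal_ne_zero.2 hr.ne'
  have hmaps : Set.MapsTo (fun z : ℂ => (r : ℂ) * z) (deltaDomain 1 (R / r) φ)
      (deltaDomain r R φ) := by
    rintro z ⟨h1, h2, h3⟩
    rw [Complex.ofReal_one] at h2 h3
    refine ⟨?_, ?_, ?_⟩
    · rw [norm_mul, Complex.norm_real, Real.norm_of_nonneg hr.le]
      rwa [lt_div_iff₀' hr] at h1
    · intro h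
      exact h2 (mul_left_cancel₀ hrc (h.trans (mul_one _).symm))
    · rwa [show (r : ℂ) * z - r = r * (z - 1) by ring, Complex.arg_real_mul _ hr]
  have hcont : Continuous fun z : ℂ => (r : ℂ) * z := by fun_prop
  refine ⟨fun z => g (r * z), ⟨R / r, φ, (one_lt_div hr).2 hR, hφ0, hφ, ?_, ?_⟩, ?_⟩
  · exact hdiff.comp (by fun_prop) hmaps
  · have htend : Tendsto (fun z : ℂ => (r : ℂ) * z) (𝓝[deltaDomain 1 (R / r) φ] ((1 : ℝ) : ℂ))
        (𝓝[deltaDomain r R φ] (r : ℂ)) := by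
      refine tendsto_nhdsWithin_iff.2 ⟨?_, ?_⟩
      · have := hcont.tendsto ((1 : ℝ) : ℂ)
        rw [Complex.ofReal_one, mul_one] at this
        rw [Complex.ofReal_one]
        exact this.mono_left nhdsWithin_le_nhds
      · exact eventually_nhdsWithin_of_forall fun z hz => hmaps hz
    have h1 := hO.comp_tendsto htend
    have h2 : ((fun t : ℂ => t - (r : ℂ)) ∘ fun z : ℂ => (r : ℂ) * z) =
        fun z => (r : ℂ) * (z - ((1 : ℝ) : ℂ)) := by
      ext z
      simp only [Function.comp_apply, Complex.ofReal_one]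
      ring
    have h3 : ((fun t : ℂ => g t - ((ϑ : ℂ) * Complex.log (1 / (1 - t / (r : ℂ))) + (K : ℂ))) ∘
        fun z : ℂ => (r : ℂ) * z) =
        fun z => g (r * z) -
          ((ϑ : ℂ) * Complex.log (1 / (1 - z / ((1 : ℝ) : ℂ))) + (K : ℂ)) := by
      ext z
      simp only [Function.comp_apply, Complex.ofReal_one, div_one]
      rw [mul_div_cancel_left₀ _ hrc]
    rw [h2, h3] at h1
    exact h1.trans (Asymptotics.isBigO_const_mul_self _ _ _)
  · have h0 : Tendsto (fun z : ℂ => (r : ℂ) * z) (𝓝 0) (𝓝 0) := by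
      have := hcont.tendsto 0
      rwa [mul_zero] at this
    filter_upwards [h0.eventually hgen] with t ht
    refine ht.congr_fun fun k => ?_
    push_cast
    ring

theorem prod_map_pow_left (r : ℂ) (s : Multiset ℕ) : (s.map fun m => r ^ m).prod = r ^ s.sum := by
  induction s using Multiset.induction_on with
  | empty => simp
  | cons a s ih => simp [ih, pow_add]

/-- The cycle lengths add up to `n`, so tilting the weights by `r^m` multiplies every summand by the
same `r^n`, which cancels when two cycle sums are compared. -/
theorem cycleSum_mul_pow (a : ℕ → ℂ) (r : ℂ) (n : ℕ) :
    cycleSum (fun m => a m * r ^ m) n = r ^ n * cycleSum a n := by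
  rw [cycleSum, cycleSum, mul_left_comm, Finset.mul_sum _ _ (r ^ n)]
  congr 1
  refine Finset.sum_congr rfl fun σ _ => ?_
  have hs : σ.partition.parts.sum = n := σ.partition.parts_sum.trans (Fintype.card_fin n)
  rw [Multiset.prod_map_mul, prod_map_pow_left, hs, mul_comm]

theorem partialSeries_rescale (θ : ℕ → ℝ) (r : ℝ) (D : Finset ℕ) :
    partialSeries (fun m => θ m * r ^ m) D 1 = partialSeries θ D r := by
  refine Finset.sum_congr rfl fun m _ => ?_
  rw [one_pow]
  ring

theorem exists_cycleSum_twistedWeight_eq_of_radius {θ : ℕ → ℝ} {r ϑ K x : ℝ} (hr : 0 < r)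
    (hϑ : 0 < ϑ) (hg : SeriesMemClass θ r ϑ K) (hx0 : 0 ≤ x) (hx1 : x < 1) :
    ∃ (C : ℝ) (N : ℕ), ∀ n : ℕ, N ≤ n → cycleSum (fun m => (θ m : ℂ)) n ≠ 0 ∧
      ∀ w : ℂ, ‖w - 1‖ ≤ 2 → ∃ ε : ℂ, ‖ε‖ ≤ C * (n : ℝ) ^ (x - 1) ∧
        cycleSum (twistedWeight θ (smallLengths n x) w) n =
          Complex.exp ((w - 1) * (partialSeries θ (smallLengths n x) r : ℂ)) * (1 + ε) *
            cycleSum (fun m => (θ m : ℂ)) n := by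
  obtain ⟨C, N, h⟩ := exists_cycleSum_twistedWeight_eq hϑ (seriesMemClass_rescale hr hg) hx0 hx1
  refine ⟨C, N, fun n hn => ?_⟩
  obtain ⟨h1, h2⟩ := h n hn
  have hrn : (r : ℂ) ^ n ≠ 0 := pow_ne_zero _ (Complex.ofReal_ne_zero.2 hr.ne')
  have e1 : cycleSum (fun m => ((θ m * r ^ m : ℝ) : ℂ)) n =
      (r : ℂ) ^ n * cycleSum (fun m => (θ m : ℂ)) n := by
    rw [← cycleSum_mul_pow]
    push_cast
    rfl
  have e2 : ∀ w : ℂ, cycleSum (twistedWeight (fun m => θ m * r ^ m) (smallLengths n x) w) n =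
      (r : ℂ) ^ n * cycleSum (twistedWeight θ (smallLengths n x) w) n := by
    intro w
    rw [← cycleSum_mul_pow]
    congr 1
    ext m
    simp only [twistedWeight]
    push_cast
    ring
  rw [e1] at h1 h2
  refine ⟨right_ne_zero_of_mul h1, fun w hw => ?_⟩
  obtain ⟨ε, hε, h3⟩ := h2 w hw
  refine ⟨ε, hε, mul_left_cancel₀ hrn ?_⟩
  rw [e2, partialSeries_rescale] at h3
  rw [h3]
  ring

/-! ### From cycle sums to the probability measure -/

theorem weight_Icc (θ : ℕ → ℝ) {n : ℕ} (σ : Equiv.Perm (Fin n)) :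
    weight θ (Finset.Icc 1 n) σ = (σ.partition.parts.map θ).prod := by
  rw [weight]
  congr 1
  refine Multiset.map_congr rfl fun m hm => ?_
  have h1 := Multiset.le_sum_of_mem hm
  rw [σ.partition.parts_sum, Fintype.card_fin] at h1
  rw [if_pos (Finset.mem_Icc.2 ⟨σ.partition.parts_pos hm, h1⟩)]

theorem weight_nonneg {θ : ℕ → ℝ} (hθ : ∀ m : ℕ, 1 ≤ m → 0 ≤ θ m) {n : ℕ}
    (σ : Equiv.Perm (Fin n)) : 0 ≤ weight θ (Finset.Icc 1 n) σ := by
  rw [weight_Icc]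
  refine Multiset.prod_nonneg fun y hy => ?_
  obtain ⟨m, hm, rfl⟩ := Multiset.mem_map.1 hy
  exact hθ m (σ.partition.parts_pos hm)

theorem ofReal_weight_Icc (θ : ℕ → ℝ) {n : ℕ} (σ : Equiv.Perm (Fin n)) :
    (weight θ (Finset.Icc 1 n) σ : ℂ) = (σ.partition.parts.map fun m => (θ m : ℂ)).prod := by
  rw [weight_Icc, ← Complex.ofRealHom_eq_coe, map_multiset_prod, Multiset.map_map]
  rfl

theorem ofReal_normConst (θ : ℕ → ℝ) (n : ℕ) :
    (normConst θ (Finset.Icc 1 n) n : ℂ) = cycleSum (fun m => (θ m : ℂ)) n := by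
  rw [normConst, cycleSum, Complex.ofReal_mul, Complex.ofReal_sum]
  simp only [ofReal_weight_Icc]
  push_cast
  rfl

theorem normConst_nonneg {θ : ℕ → ℝ} (hθ : ∀ m : ℕ, 1 ≤ m → 0 ≤ θ m) (n : ℕ) :
    0 ≤ normConst θ (Finset.Icc 1 n) n :=
  mul_nonneg (by positivity) (Finset.sum_nonneg fun σ _ => weight_nonneg hθ σ)

theorem prod_map_ite_eq_pow (D : Finset ℕ) (w : ℂ) (s : Multiset ℕ) :
    (s.map fun m => if m ∈ D then w else 1).prod = w ^ ∑ m ∈ D, s.count m := by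
  induction s using Multiset.induction_on with
  | empty => simp
  | cons a s ih =>
    rw [Multiset.map_cons, Multiset.prod_cons, ih]
    simp only [Multiset.count_cons, Finset.sum_add_distrib, Finset.sum_ite_eq', pow_add]
    split_ifs <;> simp [mul_comm]

theorem prod_map_twistedWeight (θ : ℕ → ℝ) (x : ℝ) (w : ℂ) {n : ℕ} (σ : Equiv.Perm (Fin n)) :
    (σ.partition.parts.map (twistedWeight θ (smallLengths n x) w)).prod =
      (weight θ (Finset.Icc 1 n) σ : ℂ) * w ^ smallCycles x σ := by
  rw [ofReal_weight_Icc, smallCycles]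
  simp only [cycleCount]
  rw [← prod_map_ite_eq_pow, ← Multiset.prod_map_mul]
  rfl

/-- Nonnegative weights ensure that `ENNReal.ofReal` truncates no mass. No positivity of the
normalization is needed: if it vanishes, both sides are zero. -/
theorem integral_freeMeasure {θ : ℕ → ℝ} (hθ : ∀ m : ℕ, 1 ≤ m → 0 ≤ θ m) {n : ℕ}
    (f : Equiv.Perm (Fin n) → ℂ) :
    ∫ σ, f σ ∂(freeMeasure θ n) = ((normConst θ (Finset.Icc 1 n) n : ℂ))⁻¹ *
      ((1 / (n.factorial : ℂ)) * ∑ σ, (weight θ (Finset.Icc 1 n) σ : ℂ) * f σ) := by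
  rw [freeMeasure, weightedMeasure, integral_finsetSum_measure]
  swap
  · intro σ _
    exact (integrable_dirac (by simp)).smul_measure ENNReal.ofReal_ne_top
  rw [Finset.mul_sum, Finset.mul_sum]
  refine Finset.sum_congr rfl fun σ _ => ?_
  have h0 : 0 ≤ 1 / (normConst θ (Finset.Icc 1 n) n * (n.factorial : ℝ)) *
      weight θ (Finset.Icc 1 n) σ :=
    mul_nonneg (one_div_nonneg.2 (mul_nonneg (normConst_nonneg hθ n) (Nat.cast_nonneg _)))
      (weight_nonneg hθ σ)
  rw [integral_smul_measure, integral_dirac, ENNReal.toReal_ofReal h0, Complex.real_smul]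
  push_cast
  rw [one_div, one_div, mul_inv]
  ring

theorem isProbabilityMeasure_freeMeasure {θ : ℕ → ℝ} (hθ : ∀ m : ℕ, 1 ≤ m → 0 ≤ θ m) {n : ℕ}
    (hn : 0 < normConst θ (Finset.Icc 1 n) n) : IsProbabilityMeasure (freeMeasure θ n) := by
  constructor
  have hf : (0 : ℝ) < n.factorial := by exact_mod_cast n.factorial_pos
  rw [freeMeasure, weightedMeasure, Measure.coe_finsetSum, Finset.sum_apply]
  simp only [Measure.smul_apply, measure_univ, smul_eq_mul, mul_one]
  rw [← ENNReal.ofReal_sum_of_nonneg fun σ _ => mul_nonneg (by positivity) (weight_nonneg hθ σ),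
    ← Finset.mul_sum, ENNReal.ofReal_eq_one]
  have h : ∑ σ : Equiv.Perm (Fin n), weight θ (Finset.Icc 1 n) σ =
      normConst θ (Finset.Icc 1 n) n * n.factorial := by
    rw [normConst]
    field_simp
  rw [h]
  field_simp

/-- The factor `e^{is}` per small cycle can be absorbed into the cycle weights, which turns the
expectation into a twisted cycle sum. -/
theorem integral_exp_smallCycles {θ : ℕ → ℝ} (hθ : ∀ m : ℕ, 1 ≤ m → 0 ≤ θ m) (n : ℕ) (x s : ℝ) :
    ∫ σ, Complex.exp (Complex.I * (s : ℂ) * (smallCycles x σ : ℂ)) ∂(freeMeasure θ n) =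
      (cycleSum (fun m => (θ m : ℂ)) n)⁻¹ * cycleSum
        (twistedWeight θ (smallLengths n x) (Complex.exp (Complex.I * (s : ℂ)))) n := by
  rw [integral_freeMeasure hθ, ofReal_normConst, cycleSum, cycleSum]
  congr 2
  refine Finset.sum_congr rfl fun σ _ => ?_
  rw [prod_map_twistedWeight, ← Complex.exp_nat_mul, mul_comm (smallCycles x σ : ℂ)]

theorem charFun_map_smallCycles (θ : ℕ → ℝ) (n : ℕ) (x s : ℝ) :
    charFun ((freeMeasure θ n).map fun σ : Equiv.Perm (Fin n) => (smallCycles x σ : ℝ)) s =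
      ∫ σ, Complex.exp (Complex.I * (s : ℂ) * (smallCycles x σ : ℂ)) ∂(freeMeasure θ n) := by
  have hm : Measurable fun σ : Equiv.Perm (Fin n) => (smallCycles x σ : ℝ) := fun _ _ => trivial
  rw [charFun_apply_real, integral_map hm.aemeasurable (by fun_prop)]
  refine integral_congr_ae (Eventually.of_forall fun σ => ?_)
  simp only [Complex.ofReal_natCast]
  congr 1
  ring

/-- The Poisson factor cancels exactly, leaving `1 + ε`; since the bound on `ε` is free of `s`, the
convergence is even uniform on the whole line. -/
theorem strongModPoisson_of_eq {θ : ℕ → ℝ} {r x C : ℝ} {N : ℕ} {ε : ℕ → ℝ → ℂ} (hx1 : x < 1)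
    (hprob : ∀ᶠ n : ℕ in atTop, IsProbabilityMeasure (freeMeasure θ n))
    (hε : ∀ n : ℕ, N ≤ n → ∀ s : ℝ, ‖ε n s‖ ≤ C * (n : ℝ) ^ (x - 1) ∧
      ∫ σ, Complex.exp (Complex.I * (s : ℂ) * (smallCycles x σ : ℂ)) ∂(freeMeasure θ n) =
        Complex.exp ((Complex.exp (Complex.I * (s : ℂ)) - 1) *
          (partialSeries θ (smallLengths n x) r : ℂ)) * (1 + ε n s)) :
    StrongModPoisson
      (fun n : ℕ => (freeMeasure θ n).map
        fun σ : Equiv.Perm (Fin n) => (smallCycles x σ : ℝ))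
      (fun n : ℕ => partialSeries θ (smallLengths n x) r) (fun _ : ℝ => 1) := by
  refine ⟨?_, TendstoUniformly.tendstoLocallyUniformly ?_⟩
  · filter_upwards [hprob] with n hn
    exact Measure.isProbabilityMeasure_map (measurable_from_top.aemeasurable)
  · rw [Metric.tendstoUniformly_iff]
    intro δ hδ
    have hlim : Tendsto (fun n : ℕ => C * (n : ℝ) ^ (x - 1)) atTop (𝓝 (C * 0)) := by
      refine Tendsto.const_mul C ?_
      have := (tendsto_rpow_neg_atTop (y := 1 - x) (by linarith)).comp
        tendsto_natCast_atTop_atTop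
      simpa [Function.comp_def] using this
    rw [mul_zero] at hlim
    filter_upwards [hlim.eventually (gt_mem_nhds hδ), eventually_ge_atTop N] with n hn1 hn2 s
    obtain ⟨h1, h2⟩ := hε n hn2 s
    rw [charFun_map_smallCycles, h2, ← mul_assoc, ← Complex.exp_add]
    have h3 : (partialSeries θ (smallLengths n x) r : ℂ) * (1 - Complex.exp (Complex.I * s)) +
        (Complex.exp (Complex.I * s) - 1) * (partialSeries θ (smallLengths n x) r : ℂ) = 0 := by
      ring
    rw [h3, Complex.exp_zero, one_mul, dist_comm, dist_eq_norm, add_sub_cancel_left]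
    exact h1.trans_lt hn1

end WeightedPerm

end

theorem mainTheorem9 (θ : ℕ → ℝ) (hθ : ∀ m : ℕ, 1 ≤ m → 0 ≤ θ m)
    (r ϑ K : ℝ) (hr : 0 < r) (hϑ : 0 < ϑ)
    (hg : WeightedPerm.SeriesMemClass θ r ϑ K)
    (x : ℝ) (hx0 : 0 ≤ x) (hx1 : x < 1) :
    (∀ᶠ n : ℕ in atTop, 0 < WeightedPerm.normConst θ (Finset.Icc 1 n) n ∧
      IsProbabilityMeasure (WeightedPerm.freeMeasure θ n)) ∧
    (∃ (ε : ℕ → ℝ → ℂ) (C : ℝ) (N : ℕ), ∀ n : ℕ, N ≤ n → ∀ s : ℝ,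
      ‖ε n s‖ ≤ C * (n : ℝ) ^ (x - 1) ∧
      ∫ σ, Complex.exp (Complex.I * (s : ℂ) * (WeightedPerm.smallCycles x σ : ℂ))
          ∂(WeightedPerm.freeMeasure θ n) =
        Complex.exp ((Complex.exp (Complex.I * (s : ℂ)) - 1) *
          (WeightedPerm.partialSeries θ (WeightedPerm.smallLengths n x) r : ℂ)) *
            (1 + ε n s)) ∧
    WeightedPerm.StrongModPoisson
      (fun n : ℕ => (WeightedPerm.freeMeasure θ n).map
        fun σ : Equiv.Perm (Fin n) => (WeightedPerm.smallCycles x σ : ℝ))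
      (fun n : ℕ => WeightedPerm.partialSeries θ (WeightedPerm.smallLengths n x) r)
      (fun _ : ℝ => 1) := by
  obtain ⟨C, N, h⟩ :=
    WeightedPerm.exists_cycleSum_twistedWeight_eq_of_radius hr hϑ hg hx0 hx1
  have hpos : ∀ n : ℕ, N ≤ n → 0 < WeightedPerm.normConst θ (Finset.Icc 1 n) n := by
    intro n hn
    -- Positivity comes from nonnegativity together with the nonvanishing given by the asymptotic
    -- lower bound.
    refine lt_of_le_of_ne (WeightedPerm.normConst_nonneg hθ n) fun h0 => (h n hn).1 ?_
    rw [← WeightedPerm.ofReal_normConst, ← h0, Complex.ofReal_zero]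
  have hprob : ∀ᶠ n : ℕ in atTop, 0 < WeightedPerm.normConst θ (Finset.Icc 1 n) n ∧
      IsProbabilityMeasure (WeightedPerm.freeMeasure θ n) := by
    filter_upwards [eventually_ge_atTop N] with n hn
    exact ⟨hpos n hn, WeightedPerm.isProbabilityMeasure_freeMeasure hθ (hpos n hn)⟩
  have hw : ∀ s : ℝ, ‖Complex.exp (Complex.I * (s : ℂ)) - 1‖ ≤ 2 := by
    intro s
    refine (norm_sub_le _ _).trans ?_
    rw [mul_comm, Complex.norm_exp_ofReal_mul_I, norm_one]
    norm_num
  -- The condition `N ≤ n` sits inside the existential so that `choose` yields a total `ε`; for `n <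
  -- N` the value is the irrelevant `0`.
  have hex : ∀ (n : ℕ) (s : ℝ), ∃ e : ℂ, N ≤ n → ‖e‖ ≤ C * (n : ℝ) ^ (x - 1) ∧
      ∫ σ, Complex.exp (Complex.I * (s : ℂ) * (WeightedPerm.smallCycles x σ : ℂ))
          ∂(WeightedPerm.freeMeasure θ n) =
        Complex.exp ((Complex.exp (Complex.I * (s : ℂ)) - 1) *
          (WeightedPerm.partialSeries θ (WeightedPerm.smallLengths n x) r : ℂ)) * (1 + e) := by
    intro n s
    by_cases hn : N ≤ n
    · obtain ⟨h1, h2⟩ := h n hn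
      obtain ⟨e, he, h3⟩ := h2 _ (hw s)
      refine ⟨e, fun _ => ⟨he, ?_⟩⟩
      rw [WeightedPerm.integral_exp_smallCycles hθ, h3]
      field_simp
    · exact ⟨0, fun h0 => absurd h0 hn⟩
  choose ε hε using hex
  have hε' := fun n hn s => hε n s hn
  exact ⟨hprob, ⟨ε, C, N, hε'⟩,
    WeightedPerm.strongModPoisson_of_eq hx1 (hprob.mono fun _ h => h.2) hε'⟩
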